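/- Let $G$ be a connected (finite-dimensional, real) Lie group with Lie algebra $\mathfrak g$, acting smoothly, freely and properly on the left on a smooth manifold $Q$, $(g,q)\mapsto gq=\Phi_g(q)$. Let $T^*Q$ carry its canonical symplectic form $\omega_Q=-d\theta$, where $\theta$ is the Liouville one-form, and the lifted action $\Phi^{T^*}_g(\alpha_q)=\alpha_q\circ T_{gq}\Phi_{g^{-1}}\in T^*_{gq}Q$. Let $J:T^*Q\to\mathfrak g^*$, $J(\alpha_q)(\xi)=\alpha_q(\xi_Q(q))$, be its momentum map, where $\xi_Q(q)=\frac{d}{dt}\big|_{t=0}\exp(t\xi)q$. Let $\mathrm{Ad}^*_g\mu=\mu\circ TR_g\circ TL_{g^{-1}}$ be the coadjoint action, where $L_g(h)=gh$ and $R_g(h)=hg$, and let $G_\mu=\{g\in G:\mathrm{Ad}^*_g\mu=\mu\}$ be the isotropy group of $\mu$. Let $\mu\in\mathfrak g^*$ be such that $G_\mu=G$. Then: 1. $J^{-1}(\mu)$ is a coisotropic submanifold of $(T^*Q,\omega_Q)$: it is an embedded submanifold, and $(T_\alpha J^{-1}(\mu))^{\perp}\subseteq T_\alpha J^{-1}(\mu)$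 for every $\alpha\in J^{-1}(\mu)$, where $\perp$ denotes the orthogonal with respect to $\omega_Q$. 2. For every $\alpha\in J^{-1}(\mu)$, $(T_\alpha J^{-1}(\mu))^{\perp}=T_\alpha\,\mathrm{Orb}(\alpha)$, where $\mathrm{Orb}(\alpha)$ is the orbit of $\alpha$ under the lifted $G$-action on $T^*Q$. 3. $J^{-1}(\mu)$ is $G$-invariant, and its characteristic quotient is $J^{-1}(\mu)/G$: two points of $J^{-1}(\mu)$ lie on the same leaf of the characteristic distribution $\ker(\omega_Q|_{J^{-1}(\mu)})$ (that is, they can be joined in $J^{-1}(\mu)$ by a finite chain of smooth curves tangent to this distribution) if and only if they lie on the same $G$-orbit. -/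

import Mathlib

open Set Topology Bundle
open scoped Manifold ContDiff

noncomputable section

namespace CotangentReduction

/-! ### Submanifolds, tangent spaces and leaves inside an ambient manifold `M` -/

section Submanifolds

variable {V : Type*} [NormedAddCommGroup V] [NormedSpace ℝ V] {H : Type*} [TopologicalSpace H]
  (I : ModelWithCorners ℝ V H) {M : Type*} [TopologicalSpace M] [ChartedSpace H M]

/-- `C` is an embedded (regular) smooth submanifold of the boundaryless manifold `M`: around each of
its points there is a smooth chart of `M` in which `C` is a fixed linear subspace of the model. -/
def IsEmbeddedSubmanifold (C : Set M) : Prop :=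
  ∃ S : Submodule ℝ V, ∀ p ∈ C, ∃ φ ∈ IsManifold.maximalAtlas I ∞ M,
    p ∈ φ.source ∧ ∀ x ∈ φ.source, x ∈ C ↔ I (φ x) ∈ S

/-- The tangent space `T_p C`: velocities at time `0` of smooth curves `(-ε, ε) → M` that run
in `C` and pass through `p` at time `0`. (The last condition is an equality in the tangent bundle;
it says that `γ 0 = p` and that the velocity of `γ` at time `0` is `X`.) -/
def tangentSpaceOf (C : Set M) (p : M) : Set (TangentSpace I p) :=
  {X | ∃ (γ : ℝ → M) (ε : ℝ), 0 < ε ∧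
    ContMDiffOn 𝓘(ℝ, ℝ) I ∞ γ (Ioo (-ε) ε) ∧ (∀ t ∈ Ioo (-ε) ε, γ t ∈ C) ∧
    (⟨γ 0, mfderiv 𝓘(ℝ, ℝ) I γ 0 (1 : ℝ)⟩ : TangentBundle I M) = ⟨p, X⟩}

/-- The orthogonal of a set `W` of tangent vectors at `p` with respect to a two-form `Ω`. -/
def orthogonalOf (Ω : ∀ p : M, TangentSpace I p → TangentSpace I p → ℝ) (p : M)
    (W : Set (TangentSpace I p)) : Set (TangentSpace I p) :=
  {X | ∀ Y ∈ W, Ω p X Y = 0}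

/-- `C` is a coisotropic submanifold of `(M, Ω)`: it is an embedded submanifold and
`(T_p C)^⊥ ⊆ T_p C` for all `p ∈ C`. -/
def IsCoisotropicSubmanifold (Ω : ∀ p : M, TangentSpace I p → TangentSpace I p → ℝ)
    (C : Set M) : Prop :=
  IsEmbeddedSubmanifold I C ∧
    ∀ p ∈ C, orthogonalOf I Ω p (tangentSpaceOf I C p) ⊆ tangentSpaceOf I C p

/-- The characteristic distribution `ker (Ω|_C)` of `C`: vectors tangent to `C` which are
`Ω`-orthogonal to all vectors tangent to `C`. -/
def characteristicDistribution (Ω : ∀ p : M, TangentSpace I p → TangentSpace I p → ℝ)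
    (C : Set M) (p : M) : Set (TangentSpace I p) :=
  {X | X ∈ tangentSpaceOf I C p ∧ ∀ Y ∈ tangentSpaceOf I C p, Ω p X Y = 0}

/-- `x, y ∈ C` are the endpoints of a smooth curve `[0, 1] → M` in `C` whose velocity lies in the
characteristic distribution of `C` at all times. -/
def JoinedByCharacteristicCurve (Ω : ∀ p : M, TangentSpace I p → TangentSpace I p → ℝ)
    (C : Set M) (x y : C) : Prop :=
  ∃ γ : ℝ → M, γ 0 = x ∧ γ 1 = y ∧ ContMDiffOn 𝓘(ℝ, ℝ) I ∞ γ (Icc 0 1) ∧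
    ∀ t ∈ Icc (0 : ℝ) 1, γ t ∈ C ∧
      mfderivWithin 𝓘(ℝ, ℝ) I γ (Icc 0 1) t (1 : ℝ) ∈ characteristicDistribution I Ω C (γ t)

/-- The characteristic equivalence relation on `C`: two points are equivalent if they lie on the
same leaf of the characteristic distribution, that is, if they are joined by a finite chain of
curves tangent to it. -/
def characteristicSetoid (Ω : ∀ p : M, TangentSpace I p → TangentSpace I p → ℝ)
    (C : Set M) : Setoid C :=
  Relation.EqvGen.setoid (JoinedByCharacteristicCurve I Ω C)

/-- The local representative of a one-form `θ` in the chart at `p`: the pull-back of `θ` to the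
model space by the inverse of that chart. -/
def localOneForm (θ : ∀ p : M, TangentSpace I p →L[ℝ] ℝ) (p : M) (x : V) :
    TangentSpace 𝓘(ℝ, V) x →L[ℝ] ℝ :=
  (θ ((extChartAt I p).symm x)).comp (mfderiv 𝓘(ℝ, V) I (extChartAt I p).symm x)

/-- The exterior derivative of a one-form `θ` on a (boundaryless) manifold, at the point `p`:
differentiate the local representative of `θ` in the chart at `p`, and pull the result back by the
chart. -/
def oneFormExtDeriv (θ : ∀ p : M, TangentSpace I p →L[ℝ] ℝ) (p : M)
    (X Y : TangentSpace I p) : ℝ :=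
  extDeriv (fun x : V ↦ ContinuousAlternatingMap.ofSubsingleton ℝ V ℝ (0 : Fin 1)
      (localOneForm I θ p x))
    (extChartAt I p p)
    ![mfderiv I 𝓘(ℝ, V) (extChartAt I p) p X, mfderiv I 𝓘(ℝ, V) (extChartAt I p) p Y]

end Submanifolds

/-! ### The cotangent bundle and its canonical symplectic form -/

section Cotangent

variable (E : Type*) [NormedAddCommGroup E] [NormedSpace ℝ E]
  (Q : Type*) [TopologicalSpace Q] [ChartedSpace E Q] [IsManifold 𝓘(ℝ, E) ∞ Q]

/-- The cotangent bundle `T*Q`; topology and smooth structure are Mathlib's for hom bundles. -/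
abbrev CotangentBundle : Type _ :=
  TotalSpace (E →L[ℝ] ℝ) (fun q : Q ↦ TangentSpace 𝓘(ℝ, E) q →L[ℝ] Bundle.Trivial Q ℝ q)

/-- The model with corners of `T*Q`. -/
abbrev cotangentModel : ModelWithCorners ℝ (E × (E →L[ℝ] ℝ)) (ModelProd E (E →L[ℝ] ℝ)) :=
  𝓘(ℝ, E).prod 𝓘(ℝ, E →L[ℝ] ℝ)

variable {E Q}

/-- The Liouville one-form, `θ(α)(X) = α(Tπ X)`. -/
def liouvilleForm (α : CotangentBundle E Q) : TangentSpace (cotangentModel E) α →L[ℝ] ℝ :=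
  (α.2 : TangentSpace 𝓘(ℝ, E) α.1 →L[ℝ] ℝ).comp
    (mfderiv (cotangentModel E) 𝓘(ℝ, E) (fun β : CotangentBundle E Q ↦ β.1) α)

/-- The canonical symplectic form `ω_Q = -dθ` on `T*Q`. -/
def canonicalForm (α : CotangentBundle E Q) (X Y : TangentSpace (cotangentModel E) α) : ℝ :=
  -oneFormExtDeriv (cotangentModel E) liouvilleForm α X Y

end Cotangent

/-! ### Lifted action, momentum map and coadjoint action -/

section Action

variable {F : Type*} [NormedAddCommGroup F] [NormedSpace ℝ F]
  {G : Type*} [TopologicalSpace G] [ChartedSpace F G] [Group G]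
  {E : Type*} [NormedAddCommGroup E] [NormedSpace ℝ E]
  {Q : Type*} [TopologicalSpace Q] [ChartedSpace E Q] [IsManifold 𝓘(ℝ, E) ∞ Q] [MulAction G Q]

/-- The lifted action on `T*Q`: `Φ_g(α_q) = α_q ∘ T_{gq} Φ_{g⁻¹} ∈ T*_{gq} Q`. The map
`T_{gq} Φ_{g⁻¹}` takes values in the tangent space at `g⁻¹ • g • q`, which is `q`. -/
def cotangentLift (g : G) (α : CotangentBundle E Q) : CotangentBundle E Q :=
  ⟨g • α.1,
    ContinuousLinearMap.comp (α.2 : TangentSpace 𝓘(ℝ, E) α.1 →L[ℝ] ℝ)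
      (mfderiv 𝓘(ℝ, E) 𝓘(ℝ, E) (fun q : Q ↦ g⁻¹ • q) (g • α.1) :
        TangentSpace 𝓘(ℝ, E) (g • α.1) →L[ℝ] TangentSpace 𝓘(ℝ, E) α.1)⟩

/-- The orbit of `α` under the lifted action. -/
def cotangentOrbit (G : Type*) [Group G] [MulAction G Q] (α : CotangentBundle E Q) :
    Set (CotangentBundle E Q) :=
  range fun g : G ↦ cotangentLift g α

/-- The infinitesimal generator `ξ_Q` of the action: `ξ_Q(q)` is the image of `ξ` under the
differential at `1` of `g ↦ g • q`, that is, the velocity of `exp(tξ) • q` at `t = 0`; as a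
continuous linear map `ξ ↦ ξ_Q(q)`. (The differential takes values in the tangent space at `1 • q`,
which is `q`.) -/
def infinitesimalGenerator (q : Q) :
    GroupLieAlgebra 𝓘(ℝ, F) G →L[ℝ] TangentSpace 𝓘(ℝ, E) q :=
  (mfderiv 𝓘(ℝ, F) 𝓘(ℝ, E) (fun g : G ↦ g • q) 1 :
    TangentSpace 𝓘(ℝ, F) (1 : G) →L[ℝ] TangentSpace 𝓘(ℝ, E) q)

/-- The momentum map `J : T*Q → 𝔤*`, `J(α_q)(ξ) = α_q(ξ_Q(q))`. -/
def momentumMap (α : CotangentBundle E Q) : GroupLieAlgebra 𝓘(ℝ, F) G →L[ℝ] ℝ :=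
  ContinuousLinearMap.comp (α.2 : TangentSpace 𝓘(ℝ, E) α.1 →L[ℝ] ℝ)
    (infinitesimalGenerator α.1)

/-- The level set `J⁻¹(μ)`. -/
def momentumLevel (E Q : Type*) [NormedAddCommGroup E] [NormedSpace ℝ E] [TopologicalSpace Q]
    [ChartedSpace E Q] [IsManifold 𝓘(ℝ, E) ∞ Q] [MulAction G Q]
    (μ : GroupLieAlgebra 𝓘(ℝ, F) G →L[ℝ] ℝ) : Set (CotangentBundle E Q) :=
  {α | momentumMap α = μ}

/-- The coadjoint action `Ad*_g μ = μ ∘ T R_g ∘ T L_{g⁻¹}`. (The composition of differentials takes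
values in the tangent space at `g⁻¹ * 1 * g`, which is `1`.) -/
def coadjoint (g : G) (μ : GroupLieAlgebra 𝓘(ℝ, F) G →L[ℝ] ℝ) :
    GroupLieAlgebra 𝓘(ℝ, F) G →L[ℝ] ℝ :=
  μ.comp
    ((mfderiv 𝓘(ℝ, F) 𝓘(ℝ, F) (fun h : G ↦ h * g) (g⁻¹ * 1)).comp
      (mfderiv 𝓘(ℝ, F) 𝓘(ℝ, F) (fun h : G ↦ g⁻¹ * h) 1) :
      TangentSpace 𝓘(ℝ, F) (1 : G) →L[ℝ] TangentSpace 𝓘(ℝ, F) (1 : G))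

/-- The isotropy group `G_μ` of `μ` for the coadjoint action. -/
def coadjointIsotropy (μ : GroupLieAlgebra 𝓘(ℝ, F) G →L[ℝ] ℝ) : Set G :=
  {g | coadjoint g μ = μ}

end Action

end CotangentReduction

set_option linter.unusedSectionVars false

namespace CotangentReduction

/-! ### Coordinates on the cotangent bundle -/

section CotangentCoordinates

variable {E : Type*} [NormedAddCommGroup E] [NormedSpace ℝ E]
  {Q : Type*} [TopologicalSpace Q] [ChartedSpace E Q] [IsManifold 𝓘(ℝ, E) ∞ Q]

/-! In a bundle chart the Liouville form is `p dq`, so `ω_Q(X, Y) = Y.2 X.1 - X.2 Y.1` on the model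
space (`canonicalForm_apply`), which is nondegenerate. Differentiating the action in charts gives
the momentum map identity `ω_Q(ξ_{T*Q}, Y) = dJ(Y)(ξ)` (`momentumDeriv_eq`).

Freeness makes `ξ ↦ ξ_Q(q)` injective (`injective_modelGenerator`), hence `dJ` is surjective,
already on vertical vectors. So `J⁻¹(μ)` is a regular level set with tangent space `ker dJ`. A
vector `X` orthogonal to `ker dJ` gives a functional `ω_Q(X, ·)` that factors through `dJ`; it is
therefore `dJ(·)(ξ)` for some `ξ`, and nondegeneracy forces `X = ξ_{T*Q}`. The orthogonal of the
level set is thus the space of generator values (`orthogonalOf_tangentSpaceOf_momentumLevel`). By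
equivariance of `J` and `G_μ = G`, the function `J` is constant on the orbits in the level set, so
these values are tangent to it: the level set is invariant and coisotropic, and its characteristic
distribution consists of the generator values.

The passage between generators and orbits rests on `exists_local_orbit_invariant`: near a point
where the generator is injective there is a map `s` whose level sets lie in single orbits, which is
unchanged by group elements near `1`, and whose differential at the point has its kernel inside the
generator values. Properness ensures that a curve in an orbit comes from group elements tending to
`1`, so its velocity is killed by `ds`; this identifies the tangent space of the orbit. Along a
characteristic curve `s` is locally constant, so the curve stays in one orbit. Conversely, group
elements near `1` move points along characteristic curves, and a neighbourhood of `1` generates the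
connected group `G`. -/

instance isManifold_cotangentBundle : IsManifold (cotangentModel E) ∞ (CotangentBundle E Q) :=
  inferInstance

theorem contMDiff_cotangentProj :
    ContMDiff (cotangentModel E) 𝓘(ℝ, E) ∞ (fun β : CotangentBundle E Q ↦ β.1) :=
  Bundle.contMDiff_proj _

theorem cotangent_extChartAt (α : CotangentBundle E Q) :
    extChartAt (cotangentModel E) α =
      ((trivializationAt E (TangentSpace 𝓘(ℝ, E)) α.1).continuousLinearMap (RingHom.id ℝ)
        (trivializationAt ℝ (Bundle.Trivial Q ℝ) α.1)).toPartialEquiv ≫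
        (extChartAt 𝓘(ℝ, E) α.1).prod (PartialEquiv.refl (E →L[ℝ] ℝ)) :=
  FiberBundle.extChartAt α

theorem mem_cotangent_chartAt_source {α β : CotangentBundle E Q} :
    β ∈ (extChartAt (cotangentModel E) α).source ↔ β.1 ∈ (chartAt E α.1).source := by
  rw [cotangent_extChartAt]
  simp only [PartialEquiv.trans_source, mem_inter_iff, PartialEquiv.prod_source, mem_preimage,
    mem_prod, PartialEquiv.refl_source, mem_univ, and_true]
  rw [Trivialization.mem_source]
  simp only [Trivialization.baseSet_continuousLinearMap, TangentBundle.trivializationAt_baseSet]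
  constructor
  · rintro ⟨h, -⟩; exact h.1
  · intro h
    refine ⟨⟨h, trivial⟩, ?_⟩
    simpa using! h

/-- Tangent vectors are trivialised by the derivative of the base chart, so covectors are
trivialised by precomposition with the derivative of its inverse. -/
theorem cotangent_extChartAt_apply {α β : CotangentBundle E Q}
    (hβ : β.1 ∈ (chartAt E α.1).source) :
    extChartAt (cotangentModel E) α β = (extChartAt 𝓘(ℝ, E) α.1 β.1,
      (β.2 : E →L[ℝ] ℝ).comp
        (mfderiv 𝓘(ℝ, E) 𝓘(ℝ, E) (extChartAt 𝓘(ℝ, E) α.1).symm (extChartAt 𝓘(ℝ, E) α.1 β.1))) := by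
  have h := TangentBundle.symmL_trivializationAt (I := 𝓘(ℝ, E)) hβ
  simp only [ModelWithCorners.range_eq_univ, mfderivWithin_univ] at h
  rw [← h, cotangent_extChartAt]
  refine Prod.ext rfl (ContinuousLinearMap.ext fun v ↦ ?_)
  change (trivializationAt ℝ (Bundle.Trivial Q ℝ) α.1).continuousLinearMapAt ℝ β.1
    (β.2 ((trivializationAt E (TangentSpace 𝓘(ℝ, E)) α.1).symmL ℝ β.1 v)) = _
  exact DFunLike.congr_fun (Bundle.Trivial.continuousLinearMapAt_trivialization ℝ Q ℝ β.1) _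

theorem cotangent_extChartAt_target (α : CotangentBundle E Q) :
    (extChartAt (cotangentModel E) α).target = (extChartAt 𝓘(ℝ, E) α.1).target ×ˢ univ := by
  rw [FiberBundle.extChartAt_target]
  congr 1
  refine inter_eq_left.2 fun x hx ↦ ?_
  have := (extChartAt 𝓘(ℝ, E) α.1).map_target hx
  rw [extChartAt_source] at this
  exact ⟨this, trivial⟩

theorem cotangent_extChartAt_symm_fst {α : CotangentBundle E Q} {z : E × (E →L[ℝ] ℝ)}
    (hz : z ∈ (extChartAt (cotangentModel E) α).target) :
    ((extChartAt (cotangentModel E) α).symm z).1 = (extChartAt 𝓘(ℝ, E) α.1).symm z.1 := by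
  have h1 := (extChartAt (cotangentModel E) α).map_target hz
  rw [mem_cotangent_chartAt_source] at h1
  have h2 := (extChartAt (cotangentModel E) α).right_inv hz
  rw [cotangent_extChartAt_apply h1] at h2
  have h3 := congrArg Prod.fst h2
  rw [← h3, PartialEquiv.left_inv _ (by rwa [extChartAt_source])]

theorem cotangent_extChartAt_symm_snd {α : CotangentBundle E Q} {z : E × (E →L[ℝ] ℝ)}
    (hz : z ∈ (extChartAt (cotangentModel E) α).target) :
    (((extChartAt (cotangentModel E) α).symm z).2 : E →L[ℝ] ℝ).comp
      (mfderiv 𝓘(ℝ, E) 𝓘(ℝ, E) (extChartAt 𝓘(ℝ, E) α.1).symm z.1) = z.2 := by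
  have h1 := (extChartAt (cotangentModel E) α).map_target hz
  rw [mem_cotangent_chartAt_source] at h1
  have h2 := (extChartAt (cotangentModel E) α).right_inv hz
  rw [cotangent_extChartAt_apply h1] at h2
  conv_rhs => rw [← h2]
  rw [show z.1 = _ from (congrArg Prod.fst h2).symm]

/-- This is `θ = p dq`: in charts the bundle projection becomes `Prod.fst`, and the covector
composed with the derivative of the inverse base chart is the fibre coordinate `z.2`. -/
theorem localOneForm_liouvilleForm {α : CotangentBundle E Q} {z : E × (E →L[ℝ] ℝ)}
    (hz : z ∈ (extChartAt (cotangentModel E) α).target) :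
    localOneForm (cotangentModel E) liouvilleForm α z =
      z.2.comp (ContinuousLinearMap.fst ℝ E (E →L[ℝ] ℝ)) := by
  have hn : (extChartAt (cotangentModel E) α).target ∈ 𝓝 z :=
    (isOpen_extChartAt_target α).mem_nhds hz
  have hz1 : z.1 ∈ (extChartAt 𝓘(ℝ, E) α.1).target := by
    rw [cotangent_extChartAt_target] at hz; exact hz.1
  have hd1 : MDifferentiableAt 𝓘(ℝ, E × (E →L[ℝ] ℝ)) (cotangentModel E)
      (extChartAt (cotangentModel E) α).symm z :=
    ((contMDiffOn_extChartAt_symm (n := 1) α).contMDiffAt hn).mdifferentiableAt one_ne_zero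
  have hd2 : MDifferentiableAt 𝓘(ℝ, E) 𝓘(ℝ, E) (extChartAt 𝓘(ℝ, E) α.1).symm z.1 :=
    ((contMDiffOn_extChartAt_symm (n := 1) α.1).contMDiffAt
      ((isOpen_extChartAt_target α.1).mem_nhds hz1)).mdifferentiableAt one_ne_zero
  have hd3 : MDifferentiableAt (cotangentModel E) 𝓘(ℝ, E) (fun β : CotangentBundle E Q ↦ β.1)
      ((extChartAt (cotangentModel E) α).symm z) :=
    contMDiff_cotangentProj.mdifferentiableAt (by simp)
  have hcomp := mfderiv_comp z hd3 hd1
  have heq : (fun β : CotangentBundle E Q ↦ β.1) ∘ (extChartAt (cotangentModel E) α).symm =ᶠ[𝓝 z]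
      (extChartAt 𝓘(ℝ, E) α.1).symm ∘ Prod.fst := by
    filter_upwards [hn] with w hw using cotangent_extChartAt_symm_fst hw
  have hfst : HasMFDerivAt 𝓘(ℝ, E × (E →L[ℝ] ℝ)) 𝓘(ℝ, E) (Prod.fst : E × (E →L[ℝ] ℝ) → E) z
      (ContinuousLinearMap.fst ℝ E (E →L[ℝ] ℝ)) :=
    (hasFDerivAt_fst (𝕜 := ℝ)).hasMFDerivAt
  have h4 : HasMFDerivAt 𝓘(ℝ, E × (E →L[ℝ] ℝ)) 𝓘(ℝ, E)
      ((extChartAt 𝓘(ℝ, E) α.1).symm ∘ Prod.fst) z _ := hd2.hasMFDerivAt.comp z hfst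
  rw [heq.mfderiv_eq, h4.mfderiv] at hcomp
  have h5 := cotangent_extChartAt_symm_snd hz
  unfold localOneForm liouvilleForm
  ext v
  have h6 := congrArg (fun L : E × (E →L[ℝ] ℝ) →L[ℝ] E ↦
    (((extChartAt (cotangentModel E) α).symm z).2 : E →L[ℝ] ℝ) (L v)) hcomp
  have h7 := congrArg (fun L : E →L[ℝ] ℝ ↦ L v.1) h5
  exact h6.symm.trans h7

theorem extDeriv_ofSubsingleton_clm {V : Type*} [NormedAddCommGroup V] [NormedSpace ℝ V]
    (L : V →L[ℝ] V →L[ℝ] ℝ) (x X Y : V) :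
    extDeriv (fun x : V ↦ ContinuousAlternatingMap.ofSubsingleton ℝ V ℝ (0 : Fin 1) (L x)) x
      ![X, Y] = L X Y - L Y X := by
  have hd : DifferentiableAt ℝ
      (fun x : V ↦ ContinuousAlternatingMap.ofSubsingleton ℝ V ℝ (0 : Fin 1) (L x)) x :=
    (ContinuousAlternatingMap.ofSubsingletonLIE (𝕜 := ℝ) (E := V) (F := ℝ) (ι := Fin 1)
      0).differentiableAt.comp x L.differentiableAt
  have h (w v : V) : fderiv ℝ (fun x ↦ L x w) x v = L v w := by
    rw [fderiv_clm_apply L.differentiableAt (differentiableAt_const w)]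
    simp
  rw [extDeriv_apply hd, Fin.sum_univ_two]
  change (-1) ^ 0 • fderiv ℝ (fun x ↦ L x Y) x X + (-1) ^ 1 • fderiv ℝ (fun x ↦ L x X) x Y = _
  rw [h, h]
  simp
  ring

/-- The chart at `α` has identity derivative at `α`, and the local form `p dq` depends linearly on
the point, so its exterior derivative is a constant antisymmetrisation. -/
theorem canonicalForm_apply (α : CotangentBundle E Q) (X Y : E × (E →L[ℝ] ℝ)) :
    canonicalForm α X Y = Y.2 X.1 - X.2 Y.1 := by
  unfold canonicalForm oneFormExtDeriv
  rw [mfderiv_extChartAt_self]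
  set L : E × (E →L[ℝ] ℝ) →L[ℝ] E × (E →L[ℝ] ℝ) →L[ℝ] ℝ :=
    ((ContinuousLinearMap.compL ℝ (E × (E →L[ℝ] ℝ)) E ℝ).flip
      (ContinuousLinearMap.fst ℝ E (E →L[ℝ] ℝ))) ∘L (ContinuousLinearMap.snd ℝ E (E →L[ℝ] ℝ))
  have heq : (fun x : E × (E →L[ℝ] ℝ) ↦ ContinuousAlternatingMap.ofSubsingleton ℝ
      (E × (E →L[ℝ] ℝ)) ℝ (0 : Fin 1) (localOneForm (cotangentModel E) liouvilleForm α x))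
      =ᶠ[𝓝 (extChartAt (cotangentModel E) α α)] fun x ↦ ContinuousAlternatingMap.ofSubsingleton ℝ
      (E × (E →L[ℝ] ℝ)) ℝ (0 : Fin 1) (L x) := by
    filter_upwards [extChartAt_target_mem_nhds (I := cotangentModel E) α] with z hz
    rw [localOneForm_liouvilleForm hz]
    rfl
  rw [heq.extDeriv_eq]
  refine (congrArg Neg.neg (extDeriv_ofSubsingleton_clm L _ X Y)).trans ?_
  change -(X.2 Y.1 - Y.2 X.1) = _
  ring

end CotangentCoordinates
/-! ### The action and its infinitesimal generator in charts -/

theorem contMDiff_smul_right (F : Type*) [NormedAddCommGroup F] [NormedSpace ℝ F]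
    {G : Type*} [TopologicalSpace G] [ChartedSpace F G] [Group G]
    {E : Type*} [NormedAddCommGroup E] [NormedSpace ℝ E]
    {Q : Type*} [TopologicalSpace Q] [ChartedSpace E Q]
    [MulAction G Q] [ContMDiffSMul 𝓘(ℝ, F) 𝓘(ℝ, E) ∞ G Q] (g : G) :
    ContMDiff 𝓘(ℝ, E) 𝓘(ℝ, E) ∞ (fun q : Q ↦ g • q) :=
  (contMDiff_smul (I := 𝓘(ℝ, F)) (I' := 𝓘(ℝ, E)) (n := ∞) (G := G) (M := Q)).comp
    (contMDiff_const.prodMk contMDiff_id)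

section ActionCharts

variable {F : Type*} [NormedAddCommGroup F] [NormedSpace ℝ F]
  {G : Type*} [TopologicalSpace G] [ChartedSpace F G] [Group G] [LieGroup 𝓘(ℝ, F) ∞ G]
  {V : Type*} [NormedAddCommGroup V] [NormedSpace ℝ V] {H : Type*} [TopologicalSpace H]
  (I : ModelWithCorners ℝ V H) [I.Boundaryless]
  {M : Type*} [TopologicalSpace M] [ChartedSpace H M] [IsManifold I ∞ M]
  [MulAction G M] [ContMDiffSMul 𝓘(ℝ, F) I ∞ G M]

theorem contMDiff_smul_left (m : M) : ContMDiff 𝓘(ℝ, F) I ∞ (fun g : G ↦ g • m) :=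
  (contMDiff_smul (I := 𝓘(ℝ, F)) (I' := I) (n := ∞) (G := G) (M := M)).comp
    (contMDiff_id.prodMk contMDiff_const)

variable (G) in
/-- The action read in the chart of `G` at `1` and the chart of `M` at `m`. -/
def actionInChart (m : M) (z : F × V) : V :=
  extChartAt I m ((extChartAt 𝓘(ℝ, F) (1 : G)).symm z.1 • (extChartAt I m).symm z.2)

theorem contDiffAt_actionInChart (m : M) {x : V} (hx : x ∈ (extChartAt I m).target) :
    ContDiffAt ℝ ∞ (actionInChart G I m) (extChartAt 𝓘(ℝ, F) (1 : G) 1, x) := by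
  rw [← contMDiffAt_iff_contDiffAt]
  have h1 : ContMDiffAt 𝓘(ℝ, F × V) 𝓘(ℝ, F) ∞
      (fun z : F × V ↦ (extChartAt 𝓘(ℝ, F) (1 : G)).symm z.1)
      (extChartAt 𝓘(ℝ, F) (1 : G) 1, x) :=
    ContMDiffAt.comp (I' := 𝓘(ℝ, F)) (extChartAt 𝓘(ℝ, F) (1 : G) 1, x)
      ((contMDiffOn_extChartAt_symm (1 : G)).contMDiffAt
        (x := extChartAt 𝓘(ℝ, F) (1 : G) 1) (extChartAt_target_mem_nhds (1 : G)))
      contDiffAt_fst.contMDiffAt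
  have h2 : ContMDiffAt 𝓘(ℝ, F × V) I ∞ (fun z : F × V ↦ (extChartAt I m).symm z.2)
      (extChartAt 𝓘(ℝ, F) (1 : G) 1, x) :=
    ContMDiffAt.comp (I' := 𝓘(ℝ, V)) (extChartAt 𝓘(ℝ, F) (1 : G) 1, x)
      ((contMDiffOn_extChartAt_symm m).contMDiffAt ((isOpen_extChartAt_target m).mem_nhds hx))
      contDiffAt_snd.contMDiffAt
  have h3 : ContMDiffAt 𝓘(ℝ, F × V) I ∞ (fun z : F × V ↦
      (extChartAt 𝓘(ℝ, F) (1 : G)).symm z.1 • (extChartAt I m).symm z.2)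
      (extChartAt 𝓘(ℝ, F) (1 : G) 1, x) := h1.smul h2
  refine ContMDiffAt.comp _ (contMDiffAt_extChartAt' ?_) h3
  have := (extChartAt I m).map_target hx
  rw [extChartAt_source] at this
  rw [extChartAt_to_inv, one_smul]
  exact this

variable (G) in
/-- The infinitesimal generator of the action read in the chart of `M` at `m`. -/
def generatorInChart (m : M) (x : V) : F →L[ℝ] V :=
  (fderiv ℝ (actionInChart G I m) (extChartAt 𝓘(ℝ, F) (1 : G) 1, x)).comp
    (ContinuousLinearMap.inl ℝ F V)

theorem contDiffAt_generatorInChart (m : M) {x : V} (hx : x ∈ (extChartAt I m).target) :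
    ContDiffAt ℝ ∞ (generatorInChart G I m : V → F →L[ℝ] V) x := by
  have h : ContDiffAt ℝ ∞ (fun y : V ↦
      fderiv ℝ (actionInChart G I m) (extChartAt 𝓘(ℝ, F) (1 : G) 1, y)) x :=
    ((contDiffAt_actionInChart (G := G) I m hx).fderiv_right (m := ∞) (by simp)).comp x
      (contDiffAt_const.prodMk contDiffAt_id)
  exact h.clm_comp contDiffAt_const

theorem actionInChart_one (m : M) {x : V} (hx : x ∈ (extChartAt I m).target) :
    actionInChart G I m (extChartAt 𝓘(ℝ, F) (1 : G) 1, x) = x := by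
  simp only [actionInChart, extChartAt_to_inv, one_smul]
  exact (extChartAt I m).right_inv hx

theorem hasFDerivAt_actionInChart_left (m : M) {x : V} (hx : x ∈ (extChartAt I m).target) :
    HasFDerivAt (fun a : F ↦ actionInChart G I m (a, x)) (generatorInChart G I m x)
      (extChartAt 𝓘(ℝ, F) (1 : G) 1) :=
  HasFDerivAt.comp (g := actionInChart G I m) (f := fun a : F ↦ (a, x))
    (extChartAt 𝓘(ℝ, F) (1 : G) 1)
    ((contDiffAt_actionInChart (G := G) I m hx).differentiableAt (by simp)).hasFDerivAt
    ((hasFDerivAt_id (𝕜 := ℝ) _).prodMk (hasFDerivAt_const x _))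

variable (F G) in
/-- The infinitesimal generator at `m` as a map between the model spaces. -/
def modelGenerator (m : M) : F →L[ℝ] V :=
  mfderiv 𝓘(ℝ, F) I (fun g : G ↦ g • m) 1

/-- The derivative of the inverse of the chart of `M` at `m`, as a map of the model space. -/
def chartSymmDeriv (m : M) (x : V) : V →L[ℝ] V :=
  mfderiv 𝓘(ℝ, V) I (extChartAt I m).symm x

theorem chartSymmDeriv_self (m : M) :
    chartSymmDeriv I m (extChartAt I m m) = ContinuousLinearMap.id ℝ V := by
  have := mfderivWithin_range_extChartAt_symm (I := I) (x := m)
  simp only [ModelWithCorners.range_eq_univ, mfderivWithin_univ] at this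
  exact this

theorem hasMFDerivAt_extChartAt_symm_self (m : M) :
    HasMFDerivAt 𝓘(ℝ, V) I (extChartAt I m).symm (extChartAt I m m)
      (ContinuousLinearMap.id ℝ V) := by
  have h := (((contMDiffOn_extChartAt_symm (I := I) (n := 1) m).contMDiffAt
    (extChartAt_target_mem_nhds m)).mdifferentiableAt one_ne_zero).hasMFDerivAt
  rw [show mfderiv 𝓘(ℝ, V) I (extChartAt I m).symm (extChartAt I m m) = _ from
    chartSymmDeriv_self I m] at h
  exact h

/-- For `g` near `1` the point stays in the chart domain, so the orbit map is the inverse chart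
after `actionInChart`; both sides are its derivative at `1`. Having this at every `x` of one fixed
chart is what makes the momentum map smooth and computable there. -/
theorem modelGenerator_extChartAt_symm (m : M) {x : V} (hx : x ∈ (extChartAt I m).target) :
    modelGenerator F G I ((extChartAt I m).symm x) =
      (chartSymmDeriv I m x).comp (generatorInChart G I m x) := by
  set a₀ := extChartAt 𝓘(ℝ, F) (1 : G) 1 with ha₀
  have hs : MDifferentiableAt 𝓘(ℝ, V) I (extChartAt I m).symm
      (actionInChart G I m (a₀, x)) := by
    rw [actionInChart_one I m hx]
    exact ((contMDiffOn_extChartAt_symm (n := 1) m).contMDiffAt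
      ((isOpen_extChartAt_target m).mem_nhds hx)).mdifferentiableAt one_ne_zero
  have h1 : HasMFDerivAt 𝓘(ℝ, F) I
      ((extChartAt I m).symm ∘ fun a : F ↦ actionInChart G I m (a, x)) a₀ _ :=
    hs.hasMFDerivAt.comp a₀ (hasFDerivAt_actionInChart_left I m hx).hasMFDerivAt
  have hc : ContinuousAt (fun a : F ↦ (extChartAt 𝓘(ℝ, F) (1 : G)).symm a •
      (extChartAt I m).symm x) a₀ :=
    ((contMDiff_smul_left (F := F) (G := G) I _).continuous.continuousAt).comp
      (continuousAt_extChartAt_symm (1 : G))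
  have heq : (fun a : F ↦ (extChartAt 𝓘(ℝ, F) (1 : G)).symm a • (extChartAt I m).symm x)
      =ᶠ[𝓝 a₀] ((extChartAt I m).symm ∘ fun a : F ↦ actionInChart G I m (a, x)) := by
    have hm : (extChartAt I m).source ∈ 𝓝 ((extChartAt 𝓘(ℝ, F) (1 : G)).symm a₀ •
        (extChartAt I m).symm x) := by
      refine (isOpen_extChartAt_source m).mem_nhds ?_
      rw [ha₀, extChartAt_to_inv, one_smul]
      exact (extChartAt I m).map_target hx
    filter_upwards [hc.preimage_mem_nhds hm] with a ha
    exact ((extChartAt I m).left_inv ha).symm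
  have h3 : HasMFDerivAt 𝓘(ℝ, F) I (fun g : G ↦ g • (extChartAt I m).symm x)
      ((extChartAt 𝓘(ℝ, F) (1 : G)).symm a₀)
      (mfderiv 𝓘(ℝ, F) I (fun g : G ↦ g • (extChartAt I m).symm x)
      ((extChartAt 𝓘(ℝ, F) (1 : G)).symm a₀)) :=
    ((contMDiff_smul_left I _).mdifferentiableAt (by simp)).hasMFDerivAt
  have h4 := hasMFDerivAt_unique
    (h3.comp a₀ (hasMFDerivAt_extChartAt_symm_self 𝓘(ℝ, F) (1 : G)))
    (h1.congr_of_eventuallyEq heq)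
  rw [actionInChart_one I m hx, ha₀, extChartAt_to_inv] at h4
  exact h4

theorem modelGenerator_eq (m : M) :
    modelGenerator F G I m = generatorInChart G I m (extChartAt I m m) := by
  have := modelGenerator_extChartAt_symm (F := F) (G := G) I m (mem_extChartAt_target m)
  rwa [extChartAt_to_inv, chartSymmDeriv_self, ContinuousLinearMap.id_comp] at this

end ActionCharts

/-! ### The momentum map in bundle charts and its derivative -/

section Momentum

variable {F : Type*} [NormedAddCommGroup F] [NormedSpace ℝ F]
  {G : Type*} [TopologicalSpace G] [ChartedSpace F G] [Group G] [LieGroup 𝓘(ℝ, F) ∞ G]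
  {E : Type*} [NormedAddCommGroup E] [NormedSpace ℝ E]
  {Q : Type*} [TopologicalSpace Q] [ChartedSpace E Q] [IsManifold 𝓘(ℝ, E) ∞ Q]
  [MulAction G Q] [ContMDiffSMul 𝓘(ℝ, F) 𝓘(ℝ, E) ∞ G Q]

variable (F G) in
/-- The momentum map with values in the dual of the model space of `G`. -/
def modelMomentumMap (α : CotangentBundle E Q) : F →L[ℝ] ℝ :=
  (momentumMap α : GroupLieAlgebra 𝓘(ℝ, F) G →L[ℝ] ℝ)

/-- The derivative of the inverse chart contained in the fibre coordinate is the same one that turns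
the generator in the chart into the true generator. -/
theorem modelMomentumMap_eq {α β : CotangentBundle E Q} (hβ : β.1 ∈ (chartAt E α.1).source) :
    modelMomentumMap F G β = (extChartAt (cotangentModel E) α β).2.comp
        (generatorInChart G 𝓘(ℝ, E) α.1 (extChartAt (cotangentModel E) α β).1) := by
  rw [cotangent_extChartAt_apply hβ]
  have hs : β.1 ∈ (extChartAt 𝓘(ℝ, E) α.1).source := by rwa [extChartAt_source]
  have h := modelGenerator_extChartAt_symm (F := F) (G := G) 𝓘(ℝ, E) α.1
    ((extChartAt 𝓘(ℝ, E) α.1).map_source hs)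
  rw [(extChartAt 𝓘(ℝ, E) α.1).left_inv hs] at h
  exact congrArg (ContinuousLinearMap.comp (β.2 : E →L[ℝ] ℝ)) h

theorem contDiffAt_comp_generatorInChart (q : Q) {z : E × (E →L[ℝ] ℝ)}
    (hz : z.1 ∈ (extChartAt 𝓘(ℝ, E) q).target) :
    ContDiffAt ℝ ∞ (fun z : E × (E →L[ℝ] ℝ) ↦ (z.2.comp (generatorInChart G 𝓘(ℝ, E) q z.1) : F →L[ℝ] ℝ))
      z :=
  contDiffAt_snd.clm_comp ((contDiffAt_generatorInChart (G := G) 𝓘(ℝ, E) q hz).comp z contDiffAt_fst)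

theorem modelMomentumMap_eventuallyEq (α : CotangentBundle E Q) :
    modelMomentumMap F G =ᶠ[𝓝 α] (fun z : E × (E →L[ℝ] ℝ) ↦
      z.2.comp (generatorInChart G 𝓘(ℝ, E) α.1 z.1)) ∘ extChartAt (cotangentModel E) α := by
  filter_upwards [extChartAt_source_mem_nhds (I := cotangentModel E) α] with β hβ
  exact modelMomentumMap_eq (mem_cotangent_chartAt_source.1 hβ)

theorem extChartAt_fst_mem_target (α : CotangentBundle E Q) :
    (extChartAt (cotangentModel E) α α).1 ∈ (extChartAt 𝓘(ℝ, E) α.1).target := by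
  have := mem_extChartAt_target (I := cotangentModel E) α
  rw [cotangent_extChartAt_target] at this
  exact this.1

variable (F G) in
theorem contMDiff_modelMomentumMap : ContMDiff (cotangentModel E) 𝓘(ℝ, F →L[ℝ] ℝ) ∞
    (modelMomentumMap F G : CotangentBundle E Q → F →L[ℝ] ℝ) := by
  intro α
  refine ContMDiffAt.congr_of_eventuallyEq ?_ (modelMomentumMap_eventuallyEq α)
  exact (contDiffAt_comp_generatorInChart (G := G) α.1 (extChartAt_fst_mem_target α)).contMDiffAt.comp α
    (contMDiffAt_extChartAt (I := cotangentModel E))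

variable (F G) in
/-- The derivative of the momentum map. -/
def momentumDeriv (α : CotangentBundle E Q) : E × (E →L[ℝ] ℝ) →L[ℝ] F →L[ℝ] ℝ :=
  mfderiv (cotangentModel E) 𝓘(ℝ, F →L[ℝ] ℝ) (modelMomentumMap F G) α

theorem momentumDeriv_apply (α : CotangentBundle E Q) (Y : E × (E →L[ℝ] ℝ)) (ξ : F) :
    momentumDeriv F G α Y ξ =
      Y.2 (generatorInChart G 𝓘(ℝ, E) α.1 (extChartAt (cotangentModel E) α α).1 ξ) +
      (extChartAt (cotangentModel E) α α).2
        (fderiv ℝ (generatorInChart G 𝓘(ℝ, E) α.1) (extChartAt (cotangentModel E) α α).1 Y.1 ξ) := by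
  set z := extChartAt (cotangentModel E) α α
  have hz := extChartAt_fst_mem_target α
  have h1 : HasFDerivAt (fun z : E × (E →L[ℝ] ℝ) ↦ z.2.comp (generatorInChart G 𝓘(ℝ, E) α.1 z.1 : F →L[ℝ] E)) _ z :=
    HasFDerivAt.clm_comp (hasFDerivAt_snd (𝕜 := ℝ))
      ((((contDiffAt_generatorInChart (G := G) 𝓘(ℝ, E) α.1 hz).differentiableAt (by simp)).hasFDerivAt).comp
        z (hasFDerivAt_fst (𝕜 := ℝ)))
  have h2 : HasMFDerivAt (cotangentModel E) 𝓘(ℝ, E × (E →L[ℝ] ℝ))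
      (extChartAt (cotangentModel E) α) α (ContinuousLinearMap.id ℝ (E × (E →L[ℝ] ℝ))) := by
    have h3 := (mdifferentiableAt_extChartAt (I := cotangentModel E)
      (mem_chart_source (ModelProd E (E →L[ℝ] ℝ)) α)).hasMFDerivAt
    rw [mfderiv_extChartAt_self] at h3
    exact h3
  have h3 := (h1.hasMFDerivAt.comp α h2).congr_of_eventuallyEq (modelMomentumMap_eventuallyEq α)
  unfold momentumDeriv
  rw [h3.mfderiv]
  change ((ContinuousLinearMap.compL ℝ F E ℝ) z.2 (fderiv ℝ (generatorInChart G 𝓘(ℝ, E) α.1) z.1 Y.1) +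
    (ContinuousLinearMap.compL ℝ F E ℝ).flip (generatorInChart G 𝓘(ℝ, E) α.1 z.1) Y.2) ξ = _
  simp
  ring

end Momentum
/-! ### The lifted action -/

section LiftedAction

variable {F : Type*} [NormedAddCommGroup F] [NormedSpace ℝ F]
  {G : Type*} [TopologicalSpace G] [ChartedSpace F G] [Group G] [LieGroup 𝓘(ℝ, F) ∞ G]
  {E : Type*} [NormedAddCommGroup E] [NormedSpace ℝ E]
  {Q : Type*} [TopologicalSpace Q] [ChartedSpace E Q] [IsManifold 𝓘(ℝ, E) ∞ Q]
  [MulAction G Q] [ContMDiffSMul 𝓘(ℝ, F) 𝓘(ℝ, E) ∞ G Q]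

/-- The covector underlying a point of the cotangent bundle, on the model space. -/
def covector (α : CotangentBundle E Q) : E →L[ℝ] ℝ :=
  (α.2 : TangentSpace 𝓘(ℝ, E) α.1 →L[ℝ] ℝ)

/-- All fibres share the model space, so comparing covectors there replaces an equality between
dependent fibres. -/
theorem cotangentBundle_ext {α β : CotangentBundle E Q} (h : α.1 = β.1)
    (h' : covector α = covector β) : α = β := by
  obtain ⟨q, p⟩ := α
  obtain ⟨q', p'⟩ := β
  cases h
  cases h'
  rfl

/-- The derivative of the translation `q ↦ g • q`, on the model space. -/
def smulDeriv (E : Type*) [NormedAddCommGroup E] [NormedSpace ℝ E] {Q : Type*}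
    [TopologicalSpace Q] [ChartedSpace E Q] {G : Type*} [SMul G Q] (g : G) (q : Q) : E →L[ℝ] E :=
  mfderiv 𝓘(ℝ, E) 𝓘(ℝ, E) (fun q : Q ↦ g • q) q

theorem covector_cotangentLift (g : G) (α : CotangentBundle E Q) :
    covector (cotangentLift g α) = (covector α).comp (smulDeriv E g⁻¹ (g • α.1)) :=
  rfl

theorem cotangentLift_fst (g : G) (α : CotangentBundle E Q) :
    (cotangentLift g α).1 = g • α.1 :=
  rfl

theorem smulDeriv_mul (F : Type*) [NormedAddCommGroup F] [NormedSpace ℝ F]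
    {G : Type*} [TopologicalSpace G] [ChartedSpace F G] [Group G]
    {E : Type*} [NormedAddCommGroup E] [NormedSpace ℝ E]
    {Q : Type*} [TopologicalSpace Q] [ChartedSpace E Q]
    [MulAction G Q] [ContMDiffSMul 𝓘(ℝ, F) 𝓘(ℝ, E) ∞ G Q] (g h : G) (q : Q) :
    smulDeriv E (g * h) q = (smulDeriv E g (h • q)).comp (smulDeriv E h q) := by
  have h1 : MDifferentiableAt 𝓘(ℝ, E) 𝓘(ℝ, E) (fun q : Q ↦ g • q) (h • q) :=
    (contMDiff_smul_right F g).mdifferentiableAt (by simp)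
  have h2 : MDifferentiableAt 𝓘(ℝ, E) 𝓘(ℝ, E) (fun q : Q ↦ h • q) q :=
    (contMDiff_smul_right F h).mdifferentiableAt (by simp)
  have h3 := mfderiv_comp q h1 h2
  have h4 : (fun q : Q ↦ g • q) ∘ (fun q : Q ↦ h • q) = fun q : Q ↦ (g * h) • q := by
    ext; simp [mul_smul]
  rw [h4] at h3
  exact h3

theorem smulDeriv_one (q : Q) : smulDeriv E (1 : G) q = ContinuousLinearMap.id ℝ E := by
  have h : (fun q : Q ↦ (1 : G) • q) = id := by ext; simp
  unfold smulDeriv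
  rw [h, mfderiv_id]
  rfl

theorem cotangentLift_one (α : CotangentBundle E Q) : cotangentLift (1 : G) α = α := by
  refine cotangentBundle_ext (one_smul G _) ?_
  rw [covector_cotangentLift, inv_one, smulDeriv_one, ContinuousLinearMap.comp_id]

theorem cotangentLift_mul (F : Type*) [NormedAddCommGroup F] [NormedSpace ℝ F]
    {G : Type*} [TopologicalSpace G] [ChartedSpace F G] [Group G]
    {E : Type*} [NormedAddCommGroup E] [NormedSpace ℝ E]
    {Q : Type*} [TopologicalSpace Q] [ChartedSpace E Q] [IsManifold 𝓘(ℝ, E) ∞ Q]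
    [MulAction G Q] [ContMDiffSMul 𝓘(ℝ, F) 𝓘(ℝ, E) ∞ G Q] (g h : G) (α : CotangentBundle E Q) :
    cotangentLift (g * h) α = cotangentLift g (cotangentLift h α) := by
  refine cotangentBundle_ext (mul_smul g h _) ?_
  rw [covector_cotangentLift, covector_cotangentLift, covector_cotangentLift, mul_inv_rev,
    smulDeriv_mul F, ContinuousLinearMap.comp_assoc, mul_smul, inv_smul_smul, cotangentLift_fst]

/-- The derivative of the chart of `Q` at `q`, as a map of the model space. -/
def chartDeriv (q q' : Q) : E →L[ℝ] E :=
  mfderiv 𝓘(ℝ, E) 𝓘(ℝ, E) (extChartAt 𝓘(ℝ, E) q) q'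

theorem chartSymmDeriv_comp_chartDeriv {q q' : Q} (hq : q' ∈ (chartAt E q).source) :
    (chartSymmDeriv 𝓘(ℝ, E) q (extChartAt 𝓘(ℝ, E) q q')).comp (chartDeriv q q') =
      ContinuousLinearMap.id ℝ E := by
  have := mfderivWithin_extChartAt_symm_comp_mfderiv_extChartAt' (I := 𝓘(ℝ, E)) (x := q) (y := q')
    (by rwa [extChartAt_source])
  simp only [ModelWithCorners.range_eq_univ, mfderivWithin_univ] at this
  exact this

theorem trivializationAt_snd_eq (α β : CotangentBundle E Q) :
    (trivializationAt (E →L[ℝ] ℝ)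
      (fun q : Q ↦ TangentSpace 𝓘(ℝ, E) q →L[ℝ] Bundle.Trivial Q ℝ q) α.1 β).2 =
      (extChartAt (cotangentModel E) α β).2 := by
  rw [cotangent_extChartAt]
  rfl

theorem cotangent_extChartAt_apply' {α β : CotangentBundle E Q}
    (hβ : β.1 ∈ (chartAt E α.1).source) :
    extChartAt (cotangentModel E) α β = (extChartAt 𝓘(ℝ, E) α.1 β.1,
      (covector β).comp (chartSymmDeriv 𝓘(ℝ, E) α.1 (extChartAt 𝓘(ℝ, E) α.1 β.1))) :=
  cotangent_extChartAt_apply hβ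

/-- In charts the new fibre coordinate is the old one composed with the derivative of `q ↦ g⁻¹ • q`
read in tangent coordinates, and that derivative depends smoothly on all parameters. -/
theorem contMDiff_cotangentLift :
    ContMDiff (𝓘(ℝ, F).prod (cotangentModel E)) (cotangentModel E) ∞
      (fun p : G × CotangentBundle E Q ↦ cotangentLift p.1 p.2) := by
  rintro ⟨g₀, α₀⟩
  set p₀ : G × CotangentBundle E Q := (g₀, α₀)
  have hb : ContMDiffAt (𝓘(ℝ, F).prod (cotangentModel E)) 𝓘(ℝ, E) ∞
      (fun p : G × CotangentBundle E Q ↦ p.1 • p.2.1) p₀ :=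
    contMDiffAt_fst.smul (contMDiff_cotangentProj.contMDiffAt.comp p₀ contMDiffAt_snd)
  have hb' : ContMDiffAt (𝓘(ℝ, F).prod (cotangentModel E)) 𝓘(ℝ, E) ∞
      (fun p : G × CotangentBundle E Q ↦ p.2.1) p₀ :=
    (contMDiff_cotangentProj.contMDiffAt.comp p₀ contMDiffAt_snd)
  refine Bundle.contMDiffAt_totalSpace.2 ⟨hb, ?_⟩
  have hf : ContMDiffAt ((𝓘(ℝ, F).prod (cotangentModel E)).prod 𝓘(ℝ, E)) 𝓘(ℝ, E) ∞
      (Function.uncurry fun (p : G × CotangentBundle E Q) (q : Q) ↦ p.1⁻¹ • q)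
      (p₀, p₀.1 • p₀.2.1) := by
    have h1 : ContMDiffAt ((𝓘(ℝ, F).prod (cotangentModel E)).prod 𝓘(ℝ, E)) 𝓘(ℝ, F) ∞
      (fun p : (G × CotangentBundle E Q) × Q ↦ p.1.1⁻¹) (p₀, p₀.1 • p₀.2.1) :=
      (contMDiffAt_fst.comp (p₀, p₀.1 • p₀.2.1) contMDiffAt_fst).inv
    exact h1.smul contMDiffAt_snd
  have e1 := hb.continuousAt.preimage_mem_nhds
    ((chartAt E (g₀ • α₀.1)).open_source.mem_nhds (mem_chart_source E (g₀ • α₀.1)))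
  have e2 := hb'.continuousAt.preimage_mem_nhds
    ((chartAt E α₀.1).open_source.mem_nhds (mem_chart_source E α₀.1))
  have hm : ContMDiffAt (𝓘(ℝ, F).prod (cotangentModel E)) 𝓘(ℝ, E →L[ℝ] E) ∞
      (fun p : G × CotangentBundle E Q ↦ (chartDeriv α₀.1 p.2.1).comp
        ((smulDeriv E p.1⁻¹ (p.1 • p.2.1)).comp
          (chartSymmDeriv 𝓘(ℝ, E) (g₀ • α₀.1) (extChartAt 𝓘(ℝ, E) (g₀ • α₀.1) (p.1 • p.2.1))))) p₀ := by
    refine (ContMDiffAt.mfderiv (m := ∞) (n := ∞) _ _ hf hb (by simp)).congr_of_eventuallyEq ?_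
    filter_upwards [e1, e2] with p hp1 hp2
    rw [inTangentCoordinates_eq_mfderiv_comp]
    rotate_left
    · exact hp1
    · simpa [p₀] using! hp2
    simp only [ModelWithCorners.range_eq_univ, mfderivWithin_univ]
    -- The tangent coordinates use the chart at `p₀.1⁻¹ • p₀.1 • p₀.2.1`, which equals `α₀.1` only
    -- propositionally; in terms of model-space maps the cancellation is a plain rewrite.
    change _ = (chartDeriv (p₀.1⁻¹ • p₀.1 • p₀.2.1) (p.1⁻¹ • p.1 • p.2.1)).comp
        ((smulDeriv E p.1⁻¹ (p.1 • p.2.1)).comp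
          (chartSymmDeriv 𝓘(ℝ, E) (g₀ • α₀.1) (extChartAt 𝓘(ℝ, E) (g₀ • α₀.1) (p.1 • p.2.1))))
    rw [inv_smul_smul, inv_smul_smul]
  have hc : ContMDiffAt (𝓘(ℝ, F).prod (cotangentModel E)) 𝓘(ℝ, E →L[ℝ] ℝ) ∞
      (fun p : G × CotangentBundle E Q ↦ (extChartAt (cotangentModel E) α₀ p.2).2) p₀ := by
    have h0 : ContMDiffAt (𝓘(ℝ, F).prod (cotangentModel E)) (cotangentModel E) ∞
      (fun p : G × CotangentBundle E Q ↦ p.2) p₀ := contMDiffAt_snd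
    have h1 : ContMDiffAt (cotangentModel E) 𝓘(ℝ, E × (E →L[ℝ] ℝ)) ∞
      (extChartAt (cotangentModel E) α₀) α₀ := contMDiffAt_extChartAt
    have h2 : ContMDiffAt (𝓘(ℝ, F).prod (cotangentModel E)) 𝓘(ℝ, E × (E →L[ℝ] ℝ)) ∞
      (fun p : G × CotangentBundle E Q ↦ extChartAt (cotangentModel E) α₀ p.2) p₀ :=
      ContMDiffAt.comp (f := fun p : G × CotangentBundle E Q ↦ p.2) p₀ h1 h0
    exact contDiffAt_snd.contMDiffAt.comp p₀ h2
  refine (hc.clm_comp hm).congr_of_eventuallyEq ?_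
  filter_upwards [e1, e2] with p hp1 hp2
  rw [trivializationAt_snd_eq (cotangentLift p₀.1 p₀.2), cotangent_extChartAt_apply' hp1,
    cotangent_extChartAt_apply' hp2, covector_cotangentLift]
  have h4 := chartSymmDeriv_comp_chartDeriv hp2
  ext v
  have h5 := fun w ↦ DFunLike.congr_fun h4 w
  simp only [ContinuousLinearMap.comp_apply, ContinuousLinearMap.id_apply] at h5
  simp only [ContinuousLinearMap.comp_apply, h5]
  rfl

end LiftedAction
/-! ### Local invariants of a smooth action with injective infinitesimal generators -/

theorem exists_continuousLinearMap_leftInverse {F V : Type*} [NormedAddCommGroup F]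
    [NormedSpace ℝ F] [NormedAddCommGroup V] [NormedSpace ℝ V] [FiniteDimensional ℝ V]
    (A : F →L[ℝ] V) (hA : Function.Injective A) :
    ∃ B : V →L[ℝ] F, B.comp A = ContinuousLinearMap.id ℝ F := by
  obtain ⟨B, hB⟩ := LinearMap.exists_leftInverse_of_injective (A : F →ₗ[ℝ] V)
    (LinearMap.ker_eq_bot.2 hA)
  refine ⟨LinearMap.toContinuousLinearMap B, ?_⟩
  ext x
  exact LinearMap.congr_fun hB x

section LocalInvariants

variable {F : Type*} [NormedAddCommGroup F] [NormedSpace ℝ F]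
  {G : Type*} [TopologicalSpace G] [ChartedSpace F G] [Group G] [LieGroup 𝓘(ℝ, F) ∞ G]
  {V : Type*} [NormedAddCommGroup V] [NormedSpace ℝ V] [FiniteDimensional ℝ V]
  {H : Type*} [TopologicalSpace H]
  (I : ModelWithCorners ℝ V H) [I.Boundaryless]
  {M : Type*} [TopologicalSpace M] [ChartedSpace H M] [IsManifold I ∞ M]
  [MulAction G M] [ContMDiffSMul 𝓘(ℝ, F) I ∞ G M]

/-- A complement of the orbit direction serves as a slice: every nearby point is a group element
near `1` applied to a slice point, and `s` records the slice point. Two nearby points of one orbit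
may still have different values of `s`, since the orbit can return; hence invariance is claimed only
for `g` near `1`. -/
theorem exists_local_orbit_invariant (m₀ : M)
    (hinj : Function.Injective (modelGenerator F G I m₀)) :
    ∃ U ∈ 𝓝 m₀, ∃ s : M → V, (∀ m ∈ U, MDifferentiableAt I 𝓘(ℝ, V) s m) ∧
      (∀ m ∈ U, ∀ m' ∈ U, s m = s m' → ∃ g : G, g • m = m') ∧
      (∀ m ∈ U, ∀ᶠ g in 𝓝 (1 : G), s (g • m) = s m) ∧
      ∀ X : V, (mfderiv I 𝓘(ℝ, V) s m₀ : V →L[ℝ] V) X = 0 →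
        X ∈ range (modelGenerator F G I m₀) := by
  rw [modelGenerator_eq] at hinj ⊢
  set e := extChartAt I m₀ with he
  set c := extChartAt 𝓘(ℝ, F) (1 : G) with hc
  set v₀ := e m₀ with hv₀
  set a₀ := c 1 with ha₀
  have hv₀t : v₀ ∈ e.target := mem_extChartAt_target m₀
  set A : F →L[ℝ] V := generatorInChart G I m₀ v₀ with hA
  obtain ⟨B, hB⟩ := exists_continuousLinearMap_leftInverse A hinj
  have hBA (x : F) : B (A x) = x := DFunLike.congr_fun hB x
  have hf : ContDiffAt ℝ ∞ (actionInChart G I m₀) (a₀, v₀) := contDiffAt_actionInChart (G := G) I m₀ hv₀t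
  -- The projection onto `ker B` along the range of `A`.
  set P : V →L[ℝ] V := ContinuousLinearMap.id ℝ V - A.comp B with hP
  have hPapp (w : V) : P w = w - A (B w) := by simp [hP]
  -- `B w` is the group coordinate and `P w` the slice coordinate of `w`. The derivative of `Θ` at
  -- `0` is then `A ∘ B + P`, the identity.
  set j : V → F × V := fun w ↦ (a₀ + B w, v₀ + P w) with hj
  have hj0 : j 0 = (a₀, v₀) := by simp [hj]
  have hjd : ContDiff ℝ ∞ j :=
    (contDiff_const.add B.contDiff).prodMk (contDiff_const.add P.contDiff)
  set Θ : V → V := actionInChart G I m₀ ∘ j with hΘ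
  have hΘ0 : Θ 0 = v₀ := by
    rw [hΘ, Function.comp_apply, hj0]
    exact actionInChart_one (G := G) I m₀ hv₀t
  -- Order `1` suffices, and finite order at a point persists on a neighbourhood, which `hU` needs
  -- for `R.symm`.
  have hΘd : ContDiffAt ℝ 1 Θ 0 :=
    (ContDiffAt.comp 0 (by rwa [hj0]) hjd.contDiffAt).of_le (by norm_num)
  have hj' : HasFDerivAt j (B.prod P) 0 :=
    (B.hasFDerivAt.const_add a₀).prodMk (P.hasFDerivAt.const_add v₀)
  have hf2 (v : V) : fderiv ℝ (actionInChart G I m₀) (a₀, v₀) (0, v) = v := by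
    have h1 : HasFDerivAt (actionInChart G I m₀) (fderiv ℝ (actionInChart G I m₀) (a₀, v₀))
      (a₀, v₀) := (hf.differentiableAt (by simp)).hasFDerivAt
    have h2 : HasFDerivAt (fun v : V ↦ (a₀, v)) (ContinuousLinearMap.inr ℝ F V) v₀ :=
      (hasFDerivAt_const a₀ v₀).prodMk (hasFDerivAt_id v₀)
    have h3 := HasFDerivAt.comp v₀ h1 h2
    have h4 : (actionInChart G I m₀ ∘ fun v : V ↦ (a₀, v)) =ᶠ[𝓝 v₀] id := by
      filter_upwards [extChartAt_target_mem_nhds m₀] with v hv using actionInChart_one (G := G) I m₀ hv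
    have h5 := h3.unique ((hasFDerivAt_id v₀).congr_of_eventuallyEq h4)
    exact DFunLike.congr_fun h5 v
  have hΘ' : HasFDerivAt Θ ((ContinuousLinearEquiv.refl ℝ V : V ≃L[ℝ] V) : V →L[ℝ] V) 0 := by
    have h1 : HasFDerivAt (actionInChart G I m₀) (fderiv ℝ (actionInChart G I m₀) (a₀, v₀))
      (j 0) := by rw [hj0]; exact (hf.differentiableAt (by simp)).hasFDerivAt
    have h2 := HasFDerivAt.comp 0 h1 hj'
    convert h2 using 1
    ext w
    have h3 : fderiv ℝ (actionInChart G I m₀) (a₀, v₀) (B w, 0) = A (B w) := rfl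
    have h4 : ((B w, P w) : F × V) = (B w, 0) + (0, P w) := by simp
    change w = fderiv ℝ (actionInChart G I m₀) (a₀, v₀) (B w, P w)
    rw [h4, map_add, h3, hf2, hPapp]
    abel
  set R := hΘd.toOpenPartialHomeomorph Θ hΘ' one_ne_zero with hR
  have hRc : ∀ w, R w = Θ w := fun w ↦ rfl
  have h0R : (0 : V) ∈ R.source := hΘd.mem_toOpenPartialHomeomorph_source hΘ' one_ne_zero
  have hv₀R : v₀ ∈ R.target := by rw [← hΘ0]; exact R.map_source h0R
  have hRs0 : R.symm v₀ = 0 := by rw [← hΘ0]; exact R.left_inv h0R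
  have hRsd : ContDiffAt ℝ 1 R.symm v₀ := by
    refine R.contDiffAt_symm (f₀' := ContinuousLinearEquiv.refl ℝ V) hv₀R ?_ ?_
    · rw [hRs0]; exact hΘ'
    · rw [hRs0]; exact hΘd
  have hRs' : HasFDerivAt R.symm (ContinuousLinearMap.id ℝ V) v₀ := by
    refine R.hasFDerivAt_symm (f' := ContinuousLinearEquiv.refl ℝ V) hv₀R ?_
    rw [hRs0]; exact hΘ'
  set s : M → V := fun m ↦ P (R.symm (e m)) with hs
  have hec : ContinuousAt e m₀ := continuousAt_extChartAt m₀
  have hRec : ContinuousAt (fun m ↦ R.symm (e m)) m₀ :=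
    ContinuousAt.comp (g := R.symm) (f := e) hRsd.continuousAt hec
  have hRe0 : R.symm (e m₀) = 0 := hRs0
  have hjc : ContinuousAt (fun m ↦ j (R.symm (e m))) m₀ :=
    hjd.continuous.continuousAt.comp hRec
  have hsm : ContinuousAt (fun m ↦ c.symm (j (R.symm (e m))).1 • e.symm (j (R.symm (e m))).2)
      m₀ := by
    have h1 : ContinuousAt (fun m ↦ c.symm (j (R.symm (e m))).1) m₀ := by
      refine ContinuousAt.comp_of_eq (y := a₀) (continuousAt_extChartAt_symm (1 : G)) hjc.fst ?_
      rw [hRe0, hj0]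
    have h2 : ContinuousAt (fun m ↦ e.symm (j (R.symm (e m))).2) m₀ := by
      refine ContinuousAt.comp_of_eq (y := v₀) (continuousAt_extChartAt_symm m₀) hjc.snd ?_
      rw [hRe0, hj0]
    have := (contMDiff_smul (I := 𝓘(ℝ, F)) (I' := I) (n := ∞) (G := G) (M := M)).continuous
    exact this.continuousAt.comp (h1.prodMk h2)
  have hU : ∀ᶠ m in 𝓝 m₀, m ∈ e.source ∧ e m ∈ R.target ∧ ContDiffAt ℝ 1 R.symm (e m) ∧
      (j (R.symm (e m))).1 ∈ c.target ∧ (j (R.symm (e m))).2 ∈ e.target ∧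
      c.symm (j (R.symm (e m))).1 • e.symm (j (R.symm (e m))).2 ∈ e.source := by
    refine Filter.Eventually.and (extChartAt_source_mem_nhds (I := I) m₀) (Filter.Eventually.and ?_ (Filter.Eventually.and ?_
      (Filter.Eventually.and ?_ (Filter.Eventually.and ?_ ?_))))
    · exact hec.preimage_mem_nhds (R.open_target.mem_nhds hv₀R)
    · exact hec.eventually (hRsd.eventually (by simp))
    · refine hjc.fst.preimage_mem_nhds ?_
      rw [hRe0, hj0]
      exact extChartAt_target_mem_nhds (I := 𝓘(ℝ, F)) (1 : G)
    · refine hjc.snd.preimage_mem_nhds ?_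
      rw [hRe0, hj0]
      exact extChartAt_target_mem_nhds (I := I) m₀
    · refine hsm.preimage_mem_nhds ?_
      rw [hRe0, hj0]
      rw [hc, ha₀, hc, he, hv₀, he, extChartAt_to_inv, extChartAt_to_inv, one_smul]
      exact extChartAt_source_mem_nhds (I := I) m₀
  have key : ∀ m, m ∈ e.source → e m ∈ R.target →
      c.symm (j (R.symm (e m))).1 • e.symm (j (R.symm (e m))).2 ∈ e.source →
      c.symm (j (R.symm (e m))).1 • e.symm (j (R.symm (e m))).2 = m := by
    intro m h1 h2 h3
    exact e.injOn h3 h1 (R.right_inv h2)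
  refine ⟨_, hU, s, ?_, ?_, ?_, ?_⟩
  · rintro m ⟨h1, h2, h3, -⟩
    have h4 : MDifferentiableAt I 𝓘(ℝ, V) e m :=
      mdifferentiableAt_extChartAt (by rwa [he, extChartAt_source] at h1)
    exact ((P.differentiableAt.comp (e m) (h3.differentiableAt one_ne_zero)).mdifferentiableAt).comp
      m h4
  · rintro m ⟨h1, h2, -, -, -, h3⟩ m' ⟨h1', h2', -, -, -, h3'⟩ hss
    have k := key m h1 h2 h3
    have k' := key m' h1' h2' h3'
    have h4 : (j (R.symm (e m))).2 = (j (R.symm (e m'))).2 := by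
      simpa [hj, hs] using hss
    rw [← h4] at k'
    refine ⟨c.symm (j (R.symm (e m'))).1 * (c.symm (j (R.symm (e m))).1)⁻¹, ?_⟩
    rw [mul_smul, inv_smul_eq_iff.2 k.symm, k']
  · rintro m ⟨h1, h2, -, h3, -, h4⟩
    set w := R.symm (e m) with hw
    have hPw : B (P w) = 0 := by rw [hPapp, map_sub, hBA, sub_self]
    have hPA (x : F) : P (A x) = 0 := by rw [hPapp, hBA, sub_self]
    have hPP : P (P w) = P w := by rw [hPapp (P w), hPw, map_zero, sub_zero]
    set ga := c.symm (j w).1 with hga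
    set a' : G → F := fun g ↦ c (g * ga) with ha'
    -- The coordinates that `g • m` ought to have: group part `a' g - a₀`, slice part unchanged.
    -- Continuity at `1` keeps them in the source of `R`, where they are the only ones.
    set w' : G → V := fun g ↦ A (a' g - a₀) + P w with hw'
    have hgas : ga ∈ c.source := c.map_target h3
    have hmul : ContinuousAt (fun g : G ↦ g * ga) 1 :=
      (contMDiff_mul_right (I := 𝓘(ℝ, F)) (n := ∞) (a := ga)).continuous.continuousAt
    have hca : ContinuousAt a' 1 := by
      refine ContinuousAt.comp_of_eq (y := ga) ?_ hmul (one_mul _)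
      exact continuousAt_extChartAt' hgas
    have hcw : ContinuousAt w' 1 :=
      (A.continuous.continuousAt.comp (hca.sub continuousAt_const)).add continuousAt_const
    have hw1 : w' 1 = w := by
      have : a' 1 = a₀ + B w := by
        simp only [ha', one_mul, hga]
        exact c.right_inv h3
      simp [hw', this, hPapp]
    have ev1 : ∀ᶠ g in 𝓝 (1 : G), w' g ∈ R.source := by
      refine hcw.preimage_mem_nhds (R.open_source.mem_nhds ?_)
      rw [hw1]
      exact R.map_target h2
    have ev2 : ∀ᶠ g in 𝓝 (1 : G), g * ga ∈ c.source := by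
      refine hmul.preimage_mem_nhds ((isOpen_extChartAt_source (1 : G)).mem_nhds ?_)
      rwa [one_mul]
    filter_upwards [ev1, ev2] with g hg1 hg2
    have hBw : B (w' g) = a' g - a₀ := by simp [hw', hBA, hPw]
    have hPw' : P (w' g) = P w := by simp [hw', hPA, hPP]
    have hjw : j (w' g) = (a' g, (j w).2) := by simp [hj, hBw, hPw']
    have hΘw : Θ (w' g) = e (g • m) := by
      have : Θ (w' g) = e (c.symm (a' g) • e.symm (j w).2) := by
        rw [hΘ, Function.comp_apply, hjw]; rfl
      rw [this, ha', c.left_inv hg2, mul_smul, key m h1 h2 h4]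
    simp only [hs]
    rw [← hΘw, ← hRc, R.left_inv hg1, hPw']
  · intro X hX
    have h1 : HasMFDerivAt I 𝓘(ℝ, V) e m₀ (ContinuousLinearMap.id ℝ V) := by
      have h3 := (mdifferentiableAt_extChartAt (I := I) (mem_chart_source H m₀)).hasMFDerivAt
      rw [mfderiv_extChartAt_self] at h3
      exact h3
    have h2 : HasMFDerivAt I 𝓘(ℝ, V) s m₀ P :=
      ((P.hasFDerivAt.comp v₀ hRs').hasMFDerivAt).comp m₀ h1
    rw [h2.mfderiv] at hX
    have hX' : P X = 0 := hX
    rw [hPapp, sub_eq_zero] at hX'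
    exact ⟨B X, hX'.symm⟩

/-- A curve `t ↦ g t • m` with `g t → 1` has velocity tangent to the orbit. -/
theorem mfderiv_mem_range_modelGenerator (m : M)
    (hinj : Function.Injective (modelGenerator F G I m)) {γ : ℝ → M} (hγ0 : γ 0 = m)
    (hγ : MDifferentiableAt 𝓘(ℝ, ℝ) I γ 0) {g : ℝ → G}
    (hg : Filter.Tendsto g (𝓝 0) (𝓝 1)) (hγg : ∀ᶠ t in 𝓝 0, γ t = g t • m) :
    (mfderiv 𝓘(ℝ, ℝ) I γ 0 (1 : ℝ) : V) ∈ range (modelGenerator F G I m) := by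
  obtain ⟨U, hU, s, hsd, -, hsg, hker⟩ := exists_local_orbit_invariant I m hinj
  refine hker _ ?_
  have h1 : s ∘ γ =ᶠ[𝓝 0] fun _ ↦ s m := by
    filter_upwards [hγg, hg.eventually (hsg m (mem_of_mem_nhds hU))] with t ht ht'
    rw [Function.comp_apply, ht, ht']
  subst hγ0
  have h2 := (hsd _ (mem_of_mem_nhds hU)).hasMFDerivAt.comp (0 : ℝ) hγ.hasMFDerivAt
  have h3 : HasMFDerivAt 𝓘(ℝ, ℝ) 𝓘(ℝ, V) (s ∘ γ) 0 (0 : ℝ →L[ℝ] V) :=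
    ((hasFDerivAt_const (𝕜 := ℝ) (s (γ 0)) (0 : ℝ)).hasMFDerivAt).congr_of_eventuallyEq h1
  have h4 := hasMFDerivAt_unique h2 h3
  exact DFunLike.congr_fun h4 (1 : ℝ)

theorem mfderiv_modelGenerator_eq_zero {m : M} {s : M → V} (hs : MDifferentiableAt I 𝓘(ℝ, V) s m)
    (h : ∀ᶠ g in 𝓝 (1 : G), s (g • m) = s m) (ξ : F) :
    (mfderiv I 𝓘(ℝ, V) s m : V →L[ℝ] V) (modelGenerator F G I m ξ) = 0 := by
  have h1 := ((contMDiff_smul_left (F := F) (G := G) I m).mdifferentiableAt (x := 1)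
    (by simp)).hasMFDerivAt
  have hs' : MDifferentiableAt I 𝓘(ℝ, V) s ((1 : G) • m) := by rwa [one_smul]
  have h2 := hs'.hasMFDerivAt.comp (1 : G) h1
  have h3 : HasMFDerivAt 𝓘(ℝ, F) 𝓘(ℝ, V) (s ∘ fun g : G ↦ g • m) 1 (0 : F →L[ℝ] V) :=
    (hasMFDerivAt_const (s m) (1 : G)).congr_of_eventuallyEq h
  have h4 := hasMFDerivAt_unique h2 h3
  rw [one_smul] at h4
  exact DFunLike.congr_fun h4 ξ

/-- A curve whose velocity is everywhere tangent to the orbits stays in one orbit. -/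
theorem exists_smul_eq_of_velocity_mem_range
    (hinj : ∀ m : M, Function.Injective (modelGenerator F G I m)) {γ : ℝ → M}
    (hγ : MDifferentiableOn 𝓘(ℝ, ℝ) I γ (Icc 0 1))
    (hv : ∀ t ∈ Icc (0 : ℝ) 1, (mfderivWithin 𝓘(ℝ, ℝ) I γ (Icc 0 1) t (1 : ℝ) : V) ∈
      range (modelGenerator F G I (γ t))) :
    ∃ g : G, g • γ 0 = γ 1 := by
  -- Near `t₀` the invariant `s` built at `γ t₀` has zero derivative along `γ`, hence is constant on
  -- a convex piece of the interval, and equal values of `s` mean the same orbit.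
  have hloc : IsLocallyConstant (fun t : Icc (0 : ℝ) 1 ↦
      (Quotient.mk (MulAction.orbitRel G M) (γ t))) := by
    rw [IsLocallyConstant.iff_eventually_eq]
    rintro ⟨t₀, ht₀⟩
    obtain ⟨U, hU, s, hsd, hss, hsg, -⟩ := exists_local_orbit_invariant I (γ t₀) (hinj _)
    have h1 : γ ⁻¹' U ∈ 𝓝[Icc 0 1] t₀ :=
      (hγ t₀ ht₀).continuousWithinAt.preimage_mem_nhdsWithin hU
    obtain ⟨ε, hε, hball⟩ := Metric.mem_nhdsWithin_iff.1 h1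
    have hconv : Convex ℝ (Metric.ball t₀ ε ∩ Icc 0 1) :=
      (convex_ball t₀ ε).inter (convex_Icc 0 1)
    have hder : ∀ t ∈ Metric.ball t₀ ε ∩ Icc 0 1,
        HasFDerivWithinAt (s ∘ γ) (0 : ℝ →L[ℝ] V) (Metric.ball t₀ ε ∩ Icc 0 1) t := by
      intro t ht
      have h2 := (hsd _ (hball ht)).hasMFDerivAt.comp_hasMFDerivWithinAt t
        (hγ t ht.2).hasMFDerivWithinAt
      obtain ⟨ξ, hξ⟩ := hv t ht.2
      have h3 := mfderiv_modelGenerator_eq_zero I (hsd _ (hball ht)) (hsg _ (hball ht)) ξ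
      rw [hξ] at h3
      have h4 := (h2.mono (s := Metric.ball t₀ ε ∩ Icc 0 1) inter_subset_right).hasFDerivWithinAt
      refine h4.congr_fderiv ?_
      ext
      exact h3
    have hconst (t : ℝ) (ht : t ∈ Metric.ball t₀ ε ∩ Icc 0 1) : s (γ t) = s (γ t₀) := by
      have := hconv.is_const_of_fderivWithin_eq_zero (𝕜 := ℝ) (f := s ∘ γ)
        (fun t ht ↦ (hder t ht).differentiableWithinAt) (fun t ht ↦ ?_) ht
        ⟨Metric.mem_ball_self hε, ht₀⟩
      · exact this
      · have hu : UniqueDiffWithinAt ℝ (Metric.ball t₀ ε ∩ Icc 0 1) t := by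
          rw [inter_comm]
          exact (uniqueDiffOn_Icc zero_lt_one t ht.2).inter (Metric.isOpen_ball.mem_nhds ht.1)
        exact (hder t ht).fderivWithin hu
    rw [Filter.eventually_iff_exists_mem]
    refine ⟨Subtype.val ⁻¹' Metric.ball t₀ ε, continuous_subtype_val.continuousAt.preimage_mem_nhds
      (Metric.ball_mem_nhds t₀ hε), fun t ht ↦ Quotient.sound ?_⟩
    have htt : (t : ℝ) ∈ Metric.ball t₀ ε ∩ Icc 0 1 := ⟨ht, t.2⟩
    obtain ⟨g, hg⟩ := hss _ (hball ⟨Metric.mem_ball_self hε, ht₀⟩) _ (hball htt) (hconst t htt).symm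
    exact ⟨g, hg⟩
  have : PreconnectedSpace (Icc (0 : ℝ) 1) := Subtype.preconnectedSpace isPreconnected_Icc
  have h := hloc.apply_eq_of_isPreconnected isPreconnected_univ
    (mem_univ (⟨1, by simp⟩ : Icc (0 : ℝ) 1)) (mem_univ (⟨0, by simp⟩ : Icc (0 : ℝ) 1))
  exact Quotient.exact h

end LocalInvariants
/-! ### Regular level sets -/

/-- An embedded submanifold is modelled on one subspace for all its points, while the kernels of
`dJ` vary; only their dimension is constant. -/
theorem exists_linearEquiv_comap_eq {V : Type*} [AddCommGroup V] [Module ℝ V]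
    [FiniteDimensional ℝ V] (S S' : Submodule ℝ V)
    (h : Module.finrank ℝ S = Module.finrank ℝ S') :
    ∃ T : V ≃ₗ[ℝ] V, ∀ x, T x ∈ S' ↔ x ∈ S := by
  obtain ⟨C, hC⟩ := Submodule.exists_isCompl S
  obtain ⟨C', hC'⟩ := Submodule.exists_isCompl S'
  have hc : Module.finrank ℝ C = Module.finrank ℝ C' := by
    have h1 := Submodule.finrank_add_eq_of_isCompl hC
    have h2 := Submodule.finrank_add_eq_of_isCompl hC'
    omega
  let e := LinearEquiv.ofFinrankEq S S' h
  let e' := LinearEquiv.ofFinrankEq C C' hc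
  refine ⟨(Submodule.prodEquivOfIsCompl S C hC).symm ≪≫ₗ (e.prodCongr e') ≪≫ₗ
    Submodule.prodEquivOfIsCompl S' C' hC', fun x ↦ ?_⟩
  obtain ⟨⟨a, b⟩, rfl⟩ := (Submodule.prodEquivOfIsCompl S C hC).surjective x
  have h1 : Submodule.prodEquivOfIsCompl S C hC (a, b) ∈ S ↔ b = 0 := by
    rw [← Submodule.prodEquivOfIsCompl_symm_apply_snd_eq_zero (h := hC),
      LinearEquiv.symm_apply_apply]
  have h2 (z : S' × C') : Submodule.prodEquivOfIsCompl S' C' hC' z ∈ S' ↔ z.2 = 0 := by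
    rw [← Submodule.prodEquivOfIsCompl_symm_apply_snd_eq_zero (h := hC'),
      LinearEquiv.symm_apply_apply]
  rw [h1, LinearEquiv.trans_apply, LinearEquiv.trans_apply, LinearEquiv.symm_apply_apply, h2]
  simp

section Flat

variable {V : Type*} [NormedAddCommGroup V] [NormedSpace ℝ V] [FiniteDimensional ℝ V]
  {W : Type*} [NormedAddCommGroup W] [NormedSpace ℝ W] [FiniteDimensional ℝ W]

/-- With `r` a right inverse of `D`, the map `Ψ z = (z - z₀) + r (h z - h z₀ - D (z - z₀))` has
identity derivative at `z₀` and satisfies `D (Ψ z) = h z - h z₀`, so it flattens the level set to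
`ker D`. -/
theorem exists_straightening {h : V → W} {U : Set V} (hU : IsOpen U) {z₀ : V} (hz₀ : z₀ ∈ U)
    (hh : ContDiffOn ℝ ∞ h U) {D : V →L[ℝ] W} (hD : HasFDerivAt h D z₀)
    (hsurj : Function.Surjective D) :
    ∃ R : OpenPartialHomeomorph V V, z₀ ∈ R.source ∧ R.source ⊆ U ∧ R z₀ = 0 ∧
      ContDiffOn ℝ ∞ R R.source ∧ ContDiffOn ℝ ∞ R.symm R.target ∧
      HasFDerivAt R.symm (ContinuousLinearMap.id ℝ V) 0 ∧
      ∀ z ∈ R.source, D (R z) = h z - h z₀ := by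
  obtain ⟨r₀, hr₀⟩ := LinearMap.exists_rightInverse_of_surjective (D : V →ₗ[ℝ] W)
    (LinearMap.range_eq_top.2 hsurj)
  set r : W →L[ℝ] V := LinearMap.toContinuousLinearMap r₀
  have hr (w : W) : D (r w) = w := LinearMap.congr_fun hr₀ w
  set Ψ : V → V := fun z ↦ (z - z₀) + r (h z - h z₀ - D (z - z₀)) with hΨ
  have hΨd : ContDiffOn ℝ ∞ Ψ U :=
    (contDiffOn_id.sub contDiffOn_const).add (r.contDiff.comp_contDiffOn
      ((hh.sub contDiffOn_const).sub (D.contDiff.comp_contDiffOn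
        (contDiffOn_id.sub contDiffOn_const))))
  have hΨat : ∀ z ∈ U, ContDiffAt ℝ ∞ Ψ z := fun z hz ↦ hΨd.contDiffAt (hU.mem_nhds hz)
  have hΨ' : HasFDerivAt Ψ ((ContinuousLinearEquiv.refl ℝ V : V ≃L[ℝ] V) : V →L[ℝ] V) z₀ := by
    have h1 : HasFDerivAt (fun z : V ↦ z - z₀) (ContinuousLinearMap.id ℝ V) z₀ :=
      (hasFDerivAt_id z₀).sub_const z₀
    have h2 := h1.add (r.hasFDerivAt.comp z₀ ((hD.sub_const (h z₀)).sub (D.hasFDerivAt.comp z₀ h1)))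
    refine h2.congr_fderiv ?_
    ext v
    simp
  have hΨ0 : Ψ z₀ = 0 := by simp [hΨ]
  have hDΨ (z : V) : D (Ψ z) = h z - h z₀ := by
    simp only [hΨ, map_add, hr]
    abel
  set R₀ := (hΨat z₀ hz₀).toOpenPartialHomeomorph Ψ hΨ' (by simp)
  -- Where the derivative of `Ψ` is invertible, the inverse is smooth at each image point;
  -- restricting to this open set makes `R.symm` smooth on its whole target.
  set O : Set V := U ∩ fderiv ℝ Ψ ⁻¹' range ((↑) : (V ≃L[ℝ] V) → V →L[ℝ] V) with hO
  have hOo : IsOpen O :=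
    (hΨd.continuousOn_fderiv_of_isOpen hU (by simp)).isOpen_inter_preimage hU
      (ContinuousLinearEquiv.isOpen)
  have hz₀O : z₀ ∈ O := ⟨hz₀, ContinuousLinearEquiv.refl ℝ V, hΨ'.fderiv.symm⟩
  set R := R₀.restrOpen O hOo
  have hRs : R.source = R₀.source ∩ O := R₀.restrOpen_source O hOo
  have hRc (z : V) : R z = Ψ z := rfl
  have hz₀R : z₀ ∈ R.source := by
    rw [hRs]
    exact ⟨(hΨat z₀ hz₀).mem_toOpenPartialHomeomorph_source hΨ' (by simp), hz₀O⟩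
  have h0R : (0 : V) ∈ R.target := by
    rw [← hΨ0]
    exact R.map_source hz₀R
  have hRs0 : R.symm 0 = z₀ := by
    rw [← hΨ0]
    exact R.left_inv hz₀R
  refine ⟨R, hz₀R, ?_, hΨ0, ?_, ?_, ?_, fun z _ ↦ hDΨ z⟩
  · rw [hRs]
    exact fun z hz ↦ hz.2.1
  · exact hΨd.mono (by rw [hRs]; exact fun z hz ↦ hz.2.1)
  · intro y hy
    have h1 := R.map_target hy
    rw [hRs] at h1
    obtain ⟨-, hzU, T, hT⟩ := h1
    refine (R.contDiffAt_symm (f₀' := T) hy ?_ (hΨat _ hzU)).contDiffWithinAt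
    rw [hT]
    exact ((hΨat _ hzU).differentiableAt (by simp)).hasFDerivAt
  · refine R.hasFDerivAt_symm (f' := ContinuousLinearEquiv.refl ℝ V) h0R ?_
    rw [hRs0]
    exact hΨ'

end Flat

section TangentSpaceOf

variable {V : Type*} [NormedAddCommGroup V] [NormedSpace ℝ V]
  {H : Type*} [TopologicalSpace H] {I : ModelWithCorners ℝ V H}
  {M : Type*} [TopologicalSpace M] [ChartedSpace H M]

theorem mem_tangentSpaceOf {C : Set M} {p : M} {X : V} {γ : ℝ → M} {ε : ℝ} (hε : 0 < ε)
    (hγ : ContMDiffOn 𝓘(ℝ, ℝ) I ∞ γ (Ioo (-ε) ε)) (hC : ∀ t ∈ Ioo (-ε) ε, γ t ∈ C)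
    (h0 : γ 0 = p) (hX : (mfderiv 𝓘(ℝ, ℝ) I γ 0 : ℝ →L[ℝ] V) 1 = X) :
    (X : TangentSpace I p) ∈ tangentSpaceOf I C p := by
  subst h0 hX
  exact ⟨γ, ε, hε, hγ, hC, rfl⟩

/-- Every tangent space is `V` by definition, so the fibre part of the equality in the tangent
bundle becomes an ordinary equality in `V`. -/
theorem exists_of_mem_tangentSpaceOf {C : Set M} {p : M} {X : V}
    (h : (X : TangentSpace I p) ∈ tangentSpaceOf I C p) :
    ∃ (γ : ℝ → M) (ε : ℝ), 0 < ε ∧ ContMDiffOn 𝓘(ℝ, ℝ) I ∞ γ (Ioo (-ε) ε) ∧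
      (∀ t ∈ Ioo (-ε) ε, γ t ∈ C) ∧ γ 0 = p ∧ (mfderiv 𝓘(ℝ, ℝ) I γ 0 : ℝ →L[ℝ] V) 1 = X := by
  obtain ⟨γ, ε, hε, hγ, hγC, hX⟩ := h
  exact ⟨γ, ε, hε, hγ, hγC, congrArg TotalSpace.proj hX, eq_of_heq (TotalSpace.mk.inj hX).2⟩

end TangentSpaceOf

section LevelSet

variable {V : Type*} [NormedAddCommGroup V] [NormedSpace ℝ V] [FiniteDimensional ℝ V]
  {H : Type*} [TopologicalSpace H] (I : ModelWithCorners ℝ V H) [I.Boundaryless]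
  {M : Type*} [TopologicalSpace M] [ChartedSpace H M] [IsManifold I ∞ M]
  {W : Type*} [NormedAddCommGroup W] [NormedSpace ℝ W] [FiniteDimensional ℝ W]

theorem exists_straightening_chart {J : M → W} (hJ : ContMDiff I 𝓘(ℝ, W) ∞ J) (p : M)
    {D : V →L[ℝ] W} (hD : D = mfderiv I 𝓘(ℝ, W) J p) (hsurj : Function.Surjective D) :
    ∃ R : OpenPartialHomeomorph V V, extChartAt I p p ∈ R.source ∧
      R.source ⊆ (extChartAt I p).target ∧ R (extChartAt I p p) = 0 ∧
      ContDiffOn ℝ ∞ R R.source ∧ ContDiffOn ℝ ∞ R.symm R.target ∧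
      HasFDerivAt R.symm (ContinuousLinearMap.id ℝ V) 0 ∧
      ∀ z ∈ R.source, D (R z) = J ((extChartAt I p).symm z) - J p := by
  have h1 : ContDiffOn ℝ ∞ (J ∘ (extChartAt I p).symm) (extChartAt I p).target := by
    rw [← contMDiffOn_iff_contDiffOn]
    exact hJ.comp_contMDiffOn (contMDiffOn_extChartAt_symm p)
  have h2 : HasFDerivAt (J ∘ (extChartAt I p).symm) D (extChartAt I p p) := by
    have h3 : MDifferentiableAt I 𝓘(ℝ, W) J ((extChartAt I p).symm (extChartAt I p p)) :=
      hJ.mdifferentiableAt (by simp)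
    have h4 := h3.hasMFDerivAt.comp _ (hasMFDerivAt_extChartAt_symm_self I p)
    rw [extChartAt_to_inv] at h4
    rw [hD]
    exact h4.hasFDerivAt
  have h5 := exists_straightening (isOpen_extChartAt_target p) (mem_extChartAt_target p) h1 h2 hsurj
  simpa only [Function.comp_apply, extChartAt_to_inv] using h5

theorem isEmbeddedSubmanifold_levelSet {J : M → W} (hJ : ContMDiff I 𝓘(ℝ, W) ∞ J) (μ : W)
    (hsurj : ∀ p, J p = μ → Function.Surjective (mfderiv I 𝓘(ℝ, W) J p : V →L[ℝ] W)) :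
    IsEmbeddedSubmanifold I {p | J p = μ} := by
  -- The model subspace is fixed before the point, as the kernel at a reference point `p₀`; for an
  -- empty level set any subspace serves.
  by_cases hne : ∃ p₀, J p₀ = μ
  swap
  · exact ⟨⊥, fun p hp ↦ (hne ⟨p, hp⟩).elim⟩
  obtain ⟨p₀, hp₀⟩ := hne
  have hfin (D : V →L[ℝ] W) (hD : Function.Surjective D) :
      Module.finrank ℝ (LinearMap.ker (D : V →ₗ[ℝ] W)) + Module.finrank ℝ W =
        Module.finrank ℝ V := by
    rw [← LinearMap.finrank_range_add_finrank_ker (D : V →ₗ[ℝ] W),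
      LinearMap.range_eq_top.2 hD, finrank_top, add_comm]
  set D₀ : V →L[ℝ] W := mfderiv I 𝓘(ℝ, W) J p₀ with hD₀
  refine ⟨LinearMap.ker (D₀ : V →ₗ[ℝ] W), fun p hp ↦ ?_⟩
  set D : V →L[ℝ] W := mfderiv I 𝓘(ℝ, W) J p with hD
  obtain ⟨R, hR1, hR2, hR0, hR3, hR4, -, hR5⟩ := exists_straightening_chart I hJ p hD (hsurj p hp)
  obtain ⟨T, hT⟩ := exists_linearEquiv_comap_eq (LinearMap.ker (D : V →ₗ[ℝ] W))
    (LinearMap.ker (D₀ : V →ₗ[ℝ] W)) (by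
      have h1 := hfin D (hsurj p hp)
      have h2 := hfin D₀ (hsurj p₀ hp₀)
      omega)
  set T' := T.toContinuousLinearEquiv
  -- Chart, straightening, then `T'` to carry the kernel at `p` to the kernel at `p₀`. Without
  -- boundary `I` is a homeomorphism, so its inverse brings the result back to `H`.
  set φ : OpenPartialHomeomorph M H := (chartAt H p).trans (I.toHomeomorph.toOpenPartialHomeomorph.trans
    (R.trans (T'.toHomeomorph.toOpenPartialHomeomorph.trans
      I.toHomeomorph.symm.toOpenPartialHomeomorph))) with hφ
  have hφs : φ.source = (extChartAt I p).source ∩ extChartAt I p ⁻¹' R.source := by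
    ext x
    simp [hφ]
  have hφt (y : H) : y ∈ φ.target ↔ T'.symm (I y) ∈ R.target := by
    have : T'.symm (I y) ∈ R.target → I.symm (R.symm (T'.symm (I y))) ∈ (chartAt H p).target := by
      intro h
      have := hR2 (R.map_target h)
      rw [extChartAt_target, I.range_eq_univ, inter_univ] at this
      exact this
    simpa [hφ] using this
  have hφc : ∀ x, φ x = I.symm (T' (R (extChartAt I p x))) := fun x ↦ rfl
  have hφc' : ∀ y, φ.symm y = (extChartAt I p).symm (R.symm (T'.symm (I y))) := fun x ↦ rfl
  refine ⟨φ, φ.mem_maximalAtlas_of_contMDiffOn ?_ ?_, ?_, fun x hx ↦ ?_⟩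
  · have h1 : ContMDiffOn I 𝓘(ℝ, V) ∞ (extChartAt I p) φ.source :=
      (contMDiffOn_extChartAt (x := p)).mono (by rw [hφs, extChartAt_source]; exact inter_subset_left)
    have h2 : ContMDiffOn I 𝓘(ℝ, V) ∞ (R ∘ extChartAt I p) φ.source :=
      (contMDiffOn_iff_contDiffOn.2 hR3).comp h1 (by rw [hφs]; exact inter_subset_right)
    have h3 : ContMDiffOn I 𝓘(ℝ, V) ∞ (T' ∘ R ∘ extChartAt I p) φ.source :=
      T'.contDiff.contMDiff.comp_contMDiffOn h2
    exact I.contMDiffOn_symm.comp h3 (by rw [I.range_eq_univ]; exact fun _ _ ↦ mem_univ _)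
  · have h1 : ContMDiffOn I 𝓘(ℝ, V) ∞ (fun y ↦ T'.symm (I y)) φ.target :=
      (T'.symm.contDiff.contMDiff.comp I.contMDiff).contMDiffOn
    have h2 : ContMDiffOn I 𝓘(ℝ, V) ∞ (fun y ↦ R.symm (T'.symm (I y))) φ.target :=
      (contMDiffOn_iff_contDiffOn.2 hR4).comp h1 fun y hy ↦ (hφt y).1 hy
    exact (contMDiffOn_extChartAt_symm p).comp h2
      fun y hy ↦ hR2 (R.map_target ((hφt y).1 hy))
  · rw [hφs]
    exact ⟨mem_extChartAt_source p, hR1⟩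
  · rw [hφs] at hx
    rw [hφc, I.right_inv (by rw [I.range_eq_univ]; trivial)]
    have h1 := hR5 _ hx.2
    rw [(extChartAt I p).left_inv hx.1, show J p = μ from hp] at h1
    change J x = μ ↔ T (R (extChartAt I p x)) ∈ _
    rw [hT, LinearMap.mem_ker]
    change _ ↔ D (R (extChartAt I p x)) = 0
    rw [h1, sub_eq_zero]

theorem mfderiv_eq_zero_of_mem_tangentSpaceOf {J : M → W} (hJ : ContMDiff I 𝓘(ℝ, W) ∞ J) (p : M)
    {X : V} (hX : (X : TangentSpace I p) ∈ tangentSpaceOf I {q | J q = J p} p) :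
    (mfderiv I 𝓘(ℝ, W) J p : V →L[ℝ] W) X = 0 := by
  obtain ⟨γ, ε, hε, hγ, hγC, rfl, rfl⟩ := exists_of_mem_tangentSpaceOf hX
  have hn : Ioo (-ε) ε ∈ 𝓝 (0 : ℝ) := Ioo_mem_nhds (by simpa) hε
  have h1 := ((hγ.contMDiffAt hn).mdifferentiableAt (by simp)).hasMFDerivAt
  have h2 : MDifferentiableAt I 𝓘(ℝ, W) J (γ 0) := hJ.mdifferentiableAt (by simp)
  have h3 := h2.hasMFDerivAt.comp (0 : ℝ) h1
  have h4 : J ∘ γ =ᶠ[𝓝 0] fun _ ↦ J (γ 0) := by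
    filter_upwards [hn] with t ht using hγC t ht
  have h5 : HasMFDerivAt 𝓘(ℝ, ℝ) 𝓘(ℝ, W) (J ∘ γ) 0 (0 : ℝ →L[ℝ] W) :=
    (hasMFDerivAt_const (J (γ 0)) (0 : ℝ)).congr_of_eventuallyEq h4
  exact DFunLike.congr_fun (hasMFDerivAt_unique h3 h5) (1 : ℝ)

/-- The straight line `t • X` lies in `ker D`, so its preimage under the straightening runs in the
level set; the velocity is still `X`, as all derivatives involved are the identity. -/
theorem mem_tangentSpaceOf_levelSet {J : M → W} (hJ : ContMDiff I 𝓘(ℝ, W) ∞ J) (p : M)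
    (hsurj : Function.Surjective (mfderiv I 𝓘(ℝ, W) J p : V →L[ℝ] W)) {X : V}
    (hX : (mfderiv I 𝓘(ℝ, W) J p : V →L[ℝ] W) X = 0) :
    (X : TangentSpace I p) ∈ tangentSpaceOf I {q | J q = J p} p := by
  set D : V →L[ℝ] W := mfderiv I 𝓘(ℝ, W) J p with hD
  obtain ⟨R, hR1, hR2, hR0, hR3, hR4, hR', hR5⟩ := exists_straightening_chart I hJ p hD hsurj
  have h0t : (0 : V) ∈ R.target := by rw [← hR0]; exact R.map_source hR1
  have hR0' : R.symm 0 = extChartAt I p p := by rw [← hR0]; exact R.left_inv hR1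
  have hlin : HasFDerivAt (fun t : ℝ ↦ t • X) ((ContinuousLinearMap.id ℝ ℝ).smulRight X) 0 :=
    (hasFDerivAt_id (𝕜 := ℝ) (0 : ℝ)).smul_const X
  have hmem : ∀ᶠ t in 𝓝 (0 : ℝ), t • X ∈ R.target := by
    refine hlin.continuousAt.preimage_mem_nhds (R.open_target.mem_nhds ?_)
    rwa [zero_smul]
  obtain ⟨ε, hε, hball⟩ := Metric.eventually_nhds_iff_ball.1 hmem
  rw [Real.ball_eq_Ioo, zero_sub, zero_add] at hball
  set γ : ℝ → M := fun t ↦ (extChartAt I p).symm (R.symm (t • X)) with hγ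
  have hγ0 : γ 0 = p := by
    simp only [hγ, zero_smul]
    rw [hR0', extChartAt_to_inv]
  have hγd : HasMFDerivAt 𝓘(ℝ, ℝ) I γ 0 ((ContinuousLinearMap.id ℝ ℝ).smulRight X) := by
    have h1 : HasFDerivAt (fun t : ℝ ↦ R.symm (t • X))
        ((ContinuousLinearMap.id ℝ ℝ).smulRight X) 0 := by
      have h2 : HasFDerivAt R.symm (ContinuousLinearMap.id ℝ V) ((0 : ℝ) • X) := by
        rwa [zero_smul]
      exact h2.comp 0 hlin
    have h3 : HasMFDerivAt 𝓘(ℝ, V) I (extChartAt I p).symm (R.symm ((0 : ℝ) • X))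
        (ContinuousLinearMap.id ℝ V) := by
      rw [zero_smul, hR0']
      exact hasMFDerivAt_extChartAt_symm_self I p
    exact h3.comp (0 : ℝ) h1.hasMFDerivAt
  refine mem_tangentSpaceOf hε ?_ ?_ hγ0 ?_
  · have h1 : ContMDiffOn 𝓘(ℝ, ℝ) 𝓘(ℝ, V) ∞ (fun t : ℝ ↦ R.symm (t • X)) (Ioo (-ε) ε) :=
      contMDiffOn_iff_contDiffOn.2 (hR4.comp (contDiff_id.smul contDiff_const).contDiffOn hball)
    exact (contMDiffOn_extChartAt_symm p).comp h1 fun t ht ↦ hR2 (R.map_target (hball t ht))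
  · intro t ht
    have h1 := hR5 _ (R.map_target (hball t ht))
    rw [R.right_inv (hball t ht), map_smul] at h1
    have hX' : D X = (0 : W) := hX
    have h2 : t • D X = (0 : W) := by rw [hX']; exact smul_zero t
    exact sub_eq_zero.1 (h1.symm.trans h2)
  · rw [hγd.mfderiv]
    exact one_smul ℝ X

end LevelSet
/-! ### Free and proper actions -/

/-- Properness makes every ultrafilter along `g` converge to an element fixing `x`, and freeness
leaves only `1`. -/
theorem tendsto_one_of_tendsto_smul {G X ι : Type*} [TopologicalSpace G] [Group G]
    [TopologicalSpace X] [MulAction G X] [ProperSMul G X] {x : X}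
    (hfree : ∀ g : G, g • x = x → g = 1) {l : Filter ι} {g : ι → G}
    (h : Filter.Tendsto (fun i ↦ g i • x) l (𝓝 x)) : Filter.Tendsto g l (𝓝 1) := by
  rw [Filter.tendsto_iff_ultrafilter]
  intro u hu
  obtain ⟨g', hg', hlim⟩ := (properSMul_iff_continuousSMul_ultrafilter_tendsto.1
    (inferInstance : ProperSMul G X)).2 (u.map fun i ↦ (g i, x)) x x
    (by
      rw [Ultrafilter.coe_map, Filter.tendsto_map'_iff, nhds_prod_eq]
      exact (h.mono_left hu).prodMk tendsto_const_nhds)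
  rw [hfree g' hg', Ultrafilter.coe_map, Filter.tendsto_map'_iff] at hlim
  exact hlim

section FreeActions

variable {F : Type*} [NormedAddCommGroup F] [NormedSpace ℝ F]
  {G : Type*} [TopologicalSpace G] [ChartedSpace F G] [Group G] [LieGroup 𝓘(ℝ, F) ∞ G]
  {V : Type*} [NormedAddCommGroup V] [NormedSpace ℝ V] {H : Type*} [TopologicalSpace H]
  (I : ModelWithCorners ℝ V H) [I.Boundaryless]
  {M : Type*} [TopologicalSpace M] [ChartedSpace H M] [IsManifold I ∞ M]
  [MulAction G M] [ContMDiffSMul 𝓘(ℝ, F) I ∞ G M]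

/-- Differentiating `(g * h) • m = g • (h • m)` at `h = 1` gives `T` as the derivative of `x ↦ g •
x`. Only linearity of `T` is needed later: a generator vanishing at `m` gives zero velocity along
the whole curve. -/
theorem mfderiv_smul_mulInvariantVectorField (ξ : F) (g : G) (m : M) :
    ∃ T : V →L[ℝ] V, (mfderiv 𝓘(ℝ, F) I (fun h : G ↦ h • m) g : F →L[ℝ] V)
      (mulInvariantVectorField (I := 𝓘(ℝ, F)) (ξ : GroupLieAlgebra 𝓘(ℝ, F) G) g) =
        T (modelGenerator F G I m ξ) := by
  have h1 : MDifferentiableAt I I (fun x : M ↦ g • x) ((1 : G) • m) :=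
    ((contMDiff_smul (I := 𝓘(ℝ, F)) (I' := I) (n := ∞) (G := G) (M := M)).comp
      (contMDiff_const.prodMk contMDiff_id)).mdifferentiableAt (by simp)
  have h2 : MDifferentiableAt 𝓘(ℝ, F) I (fun h : G ↦ h • m) 1 :=
    (contMDiff_smul_left I m).mdifferentiableAt (by simp)
  have h3 : MDifferentiableAt 𝓘(ℝ, F) I (fun h : G ↦ h • m) (g * 1) :=
    (contMDiff_smul_left I m).mdifferentiableAt (by simp)
  have h4 : MDifferentiableAt 𝓘(ℝ, F) 𝓘(ℝ, F) (fun h : G ↦ g * h) 1 :=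
    (contMDiff_mul_left (I := 𝓘(ℝ, F)) (n := ∞)).mdifferentiableAt (by simp)
  have h5 := h3.hasMFDerivAt.comp (1 : G) h4.hasMFDerivAt
  have h6 : (fun h : G ↦ h • m) ∘ (fun h : G ↦ g * h) =
      (fun x : M ↦ g • x) ∘ (fun h : G ↦ h • m) := by
    ext h
    exact mul_smul g h m
  rw [h6] at h5
  have h7 := hasMFDerivAt_unique h5 (h1.hasMFDerivAt.comp (1 : G) h2.hasMFDerivAt)
  rw [mul_one] at h7
  exact ⟨_, DFunLike.congr_fun h7 ξ⟩

/-- If `ξ` generates the zero vector at `m`, the integral curve `g t` of the left-invariant field of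
`ξ` through `1` moves `m` with zero velocity. So `g t • m = m` for small `t`, freeness gives `g t =
1`, and the initial velocity `ξ` is zero. -/
theorem injective_modelGenerator [CompleteSpace F] {m : M}
    (hfree : ∀ g : G, g • m = m → g = 1) :
    Function.Injective (modelGenerator F G I m) := by
  rw [injective_iff_map_eq_zero]
  intro ξ hξ
  have : LieGroup 𝓘(ℝ, F) (minSmoothness ℝ 3) G := by
    rw [minSmoothness_of_isRCLikeNormedField]
    exact LieGroup.of_le (n := ∞) ENat.LEInfty.out
  have : LieGroup 𝓘(ℝ, F) 3 G := LieGroup.of_le (n := ∞) ENat.LEInfty.out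
  have : IsManifold 𝓘(ℝ, F) 1 G := IsManifold.of_le (n := 3) (by norm_num)
  obtain ⟨g, hg0, hg⟩ := exists_isMIntegralCurveAt_of_contMDiffAt_boundaryless (I := 𝓘(ℝ, F))
    (v := mulInvariantVectorField (ξ : GroupLieAlgebra 𝓘(ℝ, F) G)) (x₀ := (1 : G)) (0 : ℝ)
    (((contMDiff_mulInvariantVectorField (ξ : GroupLieAlgebra 𝓘(ℝ, F) G)).of_le
      (by rw [minSmoothness_of_isRCLikeNormedField]; norm_num)) 1)
  have hγ : ∀ᶠ t in 𝓝 (0 : ℝ), HasMFDerivAt 𝓘(ℝ, ℝ) I (fun t ↦ g t • m) t (0 : ℝ →L[ℝ] V) := by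
    filter_upwards [hg] with t ht
    have h1 := (((contMDiff_smul_left (F := F) (G := G) I m).mdifferentiableAt (x := g t)
      (by simp)).hasMFDerivAt).comp t ht
    obtain ⟨T, hT⟩ := mfderiv_smul_mulInvariantVectorField I ξ (g t) m
    rw [hξ, map_zero] at hT
    refine h1.congr_mfderiv (ContinuousLinearMap.ext_ring ?_)
    change (mfderiv 𝓘(ℝ, F) I (fun h : G ↦ h • m) (g t) : F →L[ℝ] V)
      ((1 : ℝ) • mulInvariantVectorField (I := 𝓘(ℝ, F)) (ξ : GroupLieAlgebra 𝓘(ℝ, F) G) (g t)) = (0 : V)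
    rw [one_smul]
    exact hT
  have hs : ∀ᶠ t in 𝓝 (0 : ℝ), g t • m ∈ (chartAt H m).source := by
    refine hγ.self_of_nhds.continuousAt.preimage_mem_nhds ((chartAt H m).open_source.mem_nhds ?_)
    rw [hg0, one_smul]
    exact mem_chart_source H m
  obtain ⟨ε, hε, hball⟩ := Metric.eventually_nhds_iff_ball.1 (hγ.and hs)
  have hder (t : ℝ) (ht : t ∈ Metric.ball (0 : ℝ) ε) :
      HasFDerivAt (fun t ↦ extChartAt I m (g t • m)) (0 : ℝ →L[ℝ] V) t := by
    have h1 := (mdifferentiableAt_extChartAt (I := I) (hball t ht).2).hasMFDerivAt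
    have h2 := (HasMFDerivAt.comp t h1 (hball t ht).1).hasFDerivAt
    refine h2.congr_fderiv ?_
    ext
    exact ContinuousLinearMap.map_zero
      (mfderiv I 𝓘(ℝ, V) (extChartAt I m) (g t • m) : V →L[ℝ] V)
  have hconst (t : ℝ) (ht : t ∈ Metric.ball (0 : ℝ) ε) : g t = 1 := by
    have h1 := (convex_ball (0 : ℝ) ε).is_const_of_fderivWithin_eq_zero (𝕜 := ℝ)
      (f := fun t ↦ extChartAt I m (g t • m))
      (fun t ht ↦ (hder t ht).differentiableAt.differentiableWithinAt)
      (fun t ht ↦ ((hder t ht).hasFDerivWithinAt).fderivWithin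
        (Metric.isOpen_ball.uniqueDiffWithinAt ht)) ht (Metric.mem_ball_self hε)
    refine hfree _ ?_
    have h2 := (extChartAt I m).injOn (by rw [extChartAt_source]; exact (hball t ht).2)
      (by rw [extChartAt_source]; exact (hball 0 (Metric.mem_ball_self hε)).2) h1
    rwa [hg0, one_smul] at h2
  have h1 : HasMFDerivAt 𝓘(ℝ, ℝ) 𝓘(ℝ, F) g 0 (0 : ℝ →L[ℝ] F) := by
    refine HasMFDerivAt.congr_of_eventuallyEq (f := fun _ ↦ (1 : G)) ?_ ?_
    · exact hasMFDerivAt_const (1 : G) (0 : ℝ)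
    · filter_upwards [Metric.ball_mem_nhds (0 : ℝ) hε] with t ht using hconst t ht
  have h2 := DFunLike.congr_fun (hasMFDerivAt_unique h1 hg.self_of_nhds) (1 : ℝ)
  have h3 : (mulInvariantVectorField (I := 𝓘(ℝ, F)) (ξ : GroupLieAlgebra 𝓘(ℝ, F) G) (1 : G)) =
      (ξ : GroupLieAlgebra 𝓘(ℝ, F) G) := by
    have h4 : (fun h : G ↦ (1 : G) * h) = id := by ext; simp
    change mfderiv 𝓘(ℝ, F) 𝓘(ℝ, F) (fun h : G ↦ (1 : G) * h) 1 ξ = ξ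
    rw [h4, mfderiv_id]
    rfl
  rw [hg0] at h2
  have h5 : (0 : F) = (1 : ℝ) • (mulInvariantVectorField (I := 𝓘(ℝ, F))
    (ξ : GroupLieAlgebra 𝓘(ℝ, F) G) (1 : G) : F) := h2
  rw [one_smul] at h5
  exact (h5.trans h3).symm

end FreeActions

/-! ### Linear algebra of momentum maps -/

theorem exists_forall_eq_apply {F : Type*} [NormedAddCommGroup F] [NormedSpace ℝ F]
    [FiniteDimensional ℝ F] (l : (F →L[ℝ] ℝ) →ₗ[ℝ] ℝ) : ∃ ξ : F, ∀ ν : F →L[ℝ] ℝ, l ν = ν ξ := by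
  let e : Module.Dual ℝ F ≃ₗ[ℝ] (F →L[ℝ] ℝ) := LinearMap.toContinuousLinearMap
  refine ⟨(Module.evalEquiv ℝ F).symm (l ∘ₗ (e : Module.Dual ℝ F →ₗ[ℝ] (F →L[ℝ] ℝ))), fun ν ↦ ?_⟩
  have h := LinearMap.congr_fun ((Module.evalEquiv ℝ F).apply_symm_apply
    (l ∘ₗ (e : Module.Dual ℝ F →ₗ[ℝ] (F →L[ℝ] ℝ)))) (e.symm ν)
  have h' : ν ((Module.evalEquiv ℝ F).symm (l ∘ₗ (e : Module.Dual ℝ F →ₗ[ℝ] (F →L[ℝ] ℝ)))) =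
      l (e (e.symm ν)) := h
  rw [h', LinearEquiv.apply_symm_apply]

/-- The functional `ω(X, ·)` vanishes on `ker D`, hence factors through `D`; a functional on the
dual of `F` is evaluation at some `ξ`. Then `ω(X, ·) = ω(L ξ, ·)`, and testing on `(0, f)` and `(v,
0)` gives `X = L ξ`. -/
theorem mem_range_of_forall_mem_ker {F : Type*} [NormedAddCommGroup F] [NormedSpace ℝ F]
    [FiniteDimensional ℝ F] {E : Type*} [NormedAddCommGroup E] [NormedSpace ℝ E]
    (D : E × (E →L[ℝ] ℝ) →L[ℝ] F →L[ℝ] ℝ) (L : F →L[ℝ] E × (E →L[ℝ] ℝ))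
    (hD : Function.Surjective D) (hL : ∀ ξ Y, Y.2 (L ξ).1 - (L ξ).2 Y.1 = D Y ξ)
    {X : E × (E →L[ℝ] ℝ)} (hX : ∀ Y, D Y = 0 → Y.2 X.1 - X.2 Y.1 = 0) : X ∈ range L := by
  let Ω : E × (E →L[ℝ] ℝ) →ₗ[ℝ] ℝ :=
    { toFun := fun Y ↦ Y.2 X.1 - X.2 Y.1
      map_add' := fun Y Z ↦ by simp; ring
      map_smul' := fun c Y ↦ by simp; ring }
  obtain ⟨r, hr⟩ := LinearMap.exists_rightInverse_of_surjective
    (D : E × (E →L[ℝ] ℝ) →ₗ[ℝ] F →L[ℝ] ℝ) (LinearMap.range_eq_top.2 hD)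
  have hr' (ν : F →L[ℝ] ℝ) : D (r ν) = ν := LinearMap.congr_fun hr ν
  obtain ⟨ξ, hξ⟩ := exists_forall_eq_apply (Ω ∘ₗ r)
  have h1 (Y : E × (E →L[ℝ] ℝ)) : Y.2 X.1 - X.2 Y.1 = Y.2 (L ξ).1 - (L ξ).2 Y.1 := by
    have h2 : Ω (Y - r (D Y)) = 0 := hX _ (by rw [map_sub, hr', sub_self])
    rw [map_sub, sub_eq_zero] at h2
    rw [hL, ← hξ]
    exact h2
  refine ⟨ξ, Prod.ext ?_ ?_⟩
  · rw [← sub_eq_zero]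
    refine SeparatingDual.eq_zero_of_forall_dual_eq_zero (R := ℝ) fun f ↦ ?_
    have := h1 (0, f)
    simp only [map_zero, sub_zero] at this
    rw [map_sub, this, sub_self]
  · ext v
    have := h1 (v, 0)
    simp only [_root_.zero_apply, zero_sub, neg_inj] at this
    exact this.symm

section LiftedGenerator

variable {F : Type*} [NormedAddCommGroup F] [NormedSpace ℝ F]
  {G : Type*} [TopologicalSpace G] [ChartedSpace F G] [Group G] [LieGroup 𝓘(ℝ, F) ∞ G]
  {E : Type*} [NormedAddCommGroup E] [NormedSpace ℝ E]
  {Q : Type*} [TopologicalSpace Q] [ChartedSpace E Q] [IsManifold 𝓘(ℝ, E) ∞ Q]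
  [MulAction G Q] [ContMDiffSMul 𝓘(ℝ, F) 𝓘(ℝ, E) ∞ G Q]

/-! ### Equivariance of the momentum map -/

/-- Differentiate `g⁻¹ • h • g • q = (g⁻¹ * h * g) • q` at `h = 1` and apply the covector `α`. -/
theorem momentumMap_cotangentLift (g : G) (α : CotangentBundle E Q) :
    (momentumMap (cotangentLift g α) : GroupLieAlgebra 𝓘(ℝ, F) G →L[ℝ] ℝ) =
      coadjoint g (momentumMap α) := by
  have h1 : MDifferentiableAt 𝓘(ℝ, E) 𝓘(ℝ, E) (fun q : Q ↦ g⁻¹ • q) ((1 : G) • g • α.1) :=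
    (contMDiff_smul_right F g⁻¹).mdifferentiableAt (by simp)
  have h2 : MDifferentiableAt 𝓘(ℝ, F) 𝓘(ℝ, E) (fun h : G ↦ h • g • α.1) 1 :=
    (contMDiff_smul_left 𝓘(ℝ, E) _).mdifferentiableAt (by simp)
  have h3 : MDifferentiableAt 𝓘(ℝ, F) 𝓘(ℝ, F) (fun h : G ↦ g⁻¹ * h) 1 :=
    (contMDiff_mul_left (I := 𝓘(ℝ, F)) (n := ∞)).mdifferentiableAt (by simp)
  have h4 : MDifferentiableAt 𝓘(ℝ, F) 𝓘(ℝ, F) (fun h : G ↦ h * g) (g⁻¹ * 1) :=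
    (contMDiff_mul_right (I := 𝓘(ℝ, F)) (n := ∞)).mdifferentiableAt (by simp)
  have h5 : MDifferentiableAt 𝓘(ℝ, F) 𝓘(ℝ, E) (fun h : G ↦ h • α.1) (g⁻¹ * 1 * g) :=
    (contMDiff_smul_left 𝓘(ℝ, E) _).mdifferentiableAt (by simp)
  have h6 := h1.hasMFDerivAt.comp (1 : G) h2.hasMFDerivAt
  have h7 := h5.hasMFDerivAt.comp (1 : G) (h4.hasMFDerivAt.comp (1 : G) h3.hasMFDerivAt)
  have h8 : (fun q : Q ↦ g⁻¹ • q) ∘ (fun h : G ↦ h • g • α.1) =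
      (fun h : G ↦ h • α.1) ∘ (fun h : G ↦ h * g) ∘ (fun h : G ↦ g⁻¹ * h) := by
    ext h
    simp [mul_smul]
  rw [h8] at h6
  have h9 := hasMFDerivAt_unique h6 h7
  rw [one_smul, mul_one, inv_mul_cancel] at h9
  have h10 : (mfderiv 𝓘(ℝ, F) 𝓘(ℝ, F) (fun h : G ↦ h * g) (g⁻¹ * 1) : F →L[ℝ] F) =
      (mfderiv 𝓘(ℝ, F) 𝓘(ℝ, F) (fun h : G ↦ h * g) g⁻¹ : F →L[ℝ] F) := by rw [mul_one]
  ext ξ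
  have h11 := congrArg (covector α) (DFunLike.congr_fun h9 ξ)
  refine h11.trans ?_
  change covector α (modelGenerator F G 𝓘(ℝ, E) α.1
      ((mfderiv 𝓘(ℝ, F) 𝓘(ℝ, F) (fun h : G ↦ h * g) g⁻¹ : F →L[ℝ] F)
        ((mfderiv 𝓘(ℝ, F) 𝓘(ℝ, F) (fun h : G ↦ g⁻¹ * h) 1 : F →L[ℝ] F) ξ))) = _
  rw [← h10]
  rfl

/-! ### The infinitesimal generator of the lifted action -/

/-- The lifted action on the cotangent bundle. -/
@[reducible] def cotangentMulAction (F : Type*) [NormedAddCommGroup F] [NormedSpace ℝ F]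
    (G : Type*) [TopologicalSpace G] [ChartedSpace F G] [Group G]
    (E : Type*) [NormedAddCommGroup E] [NormedSpace ℝ E]
    (Q : Type*) [TopologicalSpace Q] [ChartedSpace E Q] [IsManifold 𝓘(ℝ, E) ∞ Q]
    [MulAction G Q] [ContMDiffSMul 𝓘(ℝ, F) 𝓘(ℝ, E) ∞ G Q] :
    MulAction G (CotangentBundle E Q) where
  smul g α := cotangentLift g α
  one_smul := cotangentLift_one
  mul_smul := cotangentLift_mul F

/-- Makes the results on smooth actions on a manifold `M` available for `T*Q`. -/
theorem contMDiffSMul_cotangentMulAction :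
    letI := cotangentMulAction F G E Q
    ContMDiffSMul 𝓘(ℝ, F) (cotangentModel E) ∞ G (CotangentBundle E Q) :=
  letI := cotangentMulAction F G E Q
  ⟨contMDiff_cotangentLift⟩

variable (F G) in
/-- The infinitesimal generator of the lifted action at `α`, as a map of the model spaces. -/
def liftGenerator (α : CotangentBundle E Q) : F →L[ℝ] E × (E →L[ℝ] ℝ) :=
  mfderiv 𝓘(ℝ, F) (cotangentModel E) (fun g : G ↦ cotangentLift g α) 1

variable (G) in
/-- The curve `a ↦ g_a α` in the orbit of `α`, in the charts at `1` and `α`. -/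
def liftInChart (α : CotangentBundle E Q) (a : F) : E × (E →L[ℝ] ℝ) :=
  extChartAt (cotangentModel E) α (cotangentLift ((extChartAt 𝓘(ℝ, F) (1 : G)).symm a) α)

theorem hasFDerivAt_liftInChart (α : CotangentBundle E Q) :
    HasFDerivAt (liftInChart G α) (liftGenerator F G α) (extChartAt 𝓘(ℝ, F) (1 : G) 1) := by
  let _ := cotangentMulAction F G E Q
  have := contMDiffSMul_cotangentMulAction (F := F) (G := G) (E := E) (Q := Q)
  have h := hasFDerivAt_actionInChart_left (F := F) (G := G) (cotangentModel E) α
    (mem_extChartAt_target α)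
  rw [← modelGenerator_eq (F := F) (G := G) (cotangentModel E) α] at h
  simp only [actionInChart, extChartAt_to_inv] at h
  exact h

theorem eventually_cotangentLift_mem (α : CotangentBundle E Q) :
    ∀ᶠ a in 𝓝 (extChartAt 𝓘(ℝ, F) (1 : G) 1),
      (extChartAt 𝓘(ℝ, F) (1 : G)).symm a • α.1 ∈ (chartAt E α.1).source := by
  have hc : ContinuousAt (fun a : F ↦ (extChartAt 𝓘(ℝ, F) (1 : G)).symm a • α.1)
      (extChartAt 𝓘(ℝ, F) (1 : G) 1) :=
    ((contMDiff_smul_left (F := F) (G := G) 𝓘(ℝ, E) _).continuous.continuousAt).comp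
      (continuousAt_extChartAt_symm (1 : G))
  refine hc.preimage_mem_nhds ((chartAt E α.1).open_source.mem_nhds ?_)
  rw [extChartAt_to_inv, one_smul]
  exact mem_chart_source E α.1

theorem extChartAt_self_eq (α : CotangentBundle E Q) :
    extChartAt (cotangentModel E) α α = (extChartAt 𝓘(ℝ, E) α.1 α.1, covector α) := by
  rw [cotangent_extChartAt_apply' (mem_chart_source E α.1), chartSymmDeriv_self,
    ContinuousLinearMap.comp_id]

theorem liftInChart_fst (α : CotangentBundle E Q) :
    ∀ᶠ a in 𝓝 (extChartAt 𝓘(ℝ, F) (1 : G) 1), (liftInChart G α a).1 =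
      actionInChart G 𝓘(ℝ, E) α.1 (a, extChartAt 𝓘(ℝ, E) α.1 α.1) := by
  filter_upwards [eventually_cotangentLift_mem (F := F) (G := G) α] with a ha
  rw [liftInChart, cotangent_extChartAt_apply' ha, actionInChart, extChartAt_to_inv]
  rfl

/-- This is `(g α) ∘ TΦ_g = α` read in charts. In this form no inverse occurs, so it can be
differentiated at `g = 1` by the product rule. -/
theorem liftInChart_snd (α : CotangentBundle E Q) :
    ∀ᶠ a in 𝓝 (extChartAt 𝓘(ℝ, F) (1 : G) 1), (liftInChart G α a).2.comp
      ((fderiv ℝ (actionInChart G 𝓘(ℝ, E) α.1) (a, extChartAt 𝓘(ℝ, E) α.1 α.1)).comp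
        (ContinuousLinearMap.inr ℝ F E)) = covector α := by
  set a₀ := extChartAt 𝓘(ℝ, F) (1 : G) 1 with ha₀
  set x₀ := extChartAt 𝓘(ℝ, E) α.1 α.1 with hx₀
  have hf := contDiffAt_actionInChart (F := F) (G := G) 𝓘(ℝ, E) α.1 (mem_extChartAt_target α.1)
  have hd : ∀ᶠ z in 𝓝 (a₀, x₀), DifferentiableAt ℝ (actionInChart G 𝓘(ℝ, E) α.1) z :=
    ((hf.of_le (m := 1) (by exact_mod_cast le_top)).eventually (by simp)).mono
      fun z hz ↦ hz.differentiableAt (by simp)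
  have hd' : ∀ᶠ a in 𝓝 a₀, DifferentiableAt ℝ (actionInChart G 𝓘(ℝ, E) α.1) (a, x₀) :=
    (Continuous.prodMk_left x₀).continuousAt.eventually hd
  filter_upwards [eventually_cotangentLift_mem (F := F) (G := G) α, hd'] with a ha had
  set g := (extChartAt 𝓘(ℝ, F) (1 : G)).symm a with hg
  have hsrc : g • α.1 ∈ (extChartAt 𝓘(ℝ, E) α.1).source := by rwa [extChartAt_source]
  have hxe : extChartAt 𝓘(ℝ, E) α.1 (g • α.1) = actionInChart G 𝓘(ℝ, E) α.1 (a, x₀) := by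
    rw [actionInChart, hx₀, extChartAt_to_inv]
  have h1 : HasFDerivAt (fun x : E ↦ actionInChart G 𝓘(ℝ, E) α.1 (a, x))
      ((fderiv ℝ (actionInChart G 𝓘(ℝ, E) α.1) (a, x₀)).comp (ContinuousLinearMap.inr ℝ F E)) x₀ :=
    HasFDerivAt.comp (g := actionInChart G 𝓘(ℝ, E) α.1) (f := fun x : E ↦ (a, x)) x₀
      had.hasFDerivAt ((hasFDerivAt_const a x₀).prodMk (hasFDerivAt_id (𝕜 := ℝ) x₀))
  have h2 : MDifferentiableAt 𝓘(ℝ, E) 𝓘(ℝ, E) (extChartAt 𝓘(ℝ, E) α.1).symm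
      (actionInChart G 𝓘(ℝ, E) α.1 (a, x₀)) := by
    rw [← hxe]
    exact ((contMDiffOn_extChartAt_symm (n := 1) α.1).contMDiffAt ((isOpen_extChartAt_target α.1).mem_nhds
      ((extChartAt 𝓘(ℝ, E) α.1).map_source hsrc))).mdifferentiableAt one_ne_zero
  have h3 := h2.hasMFDerivAt.comp x₀ h1.hasMFDerivAt
  have h4 : MDifferentiableAt 𝓘(ℝ, E) 𝓘(ℝ, E) (fun q : Q ↦ g • q)
      ((extChartAt 𝓘(ℝ, E) α.1).symm x₀) :=
    (contMDiff_smul_right F g).mdifferentiableAt (by simp)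
  have h5 := h4.hasMFDerivAt.comp x₀ (hasMFDerivAt_extChartAt_symm_self 𝓘(ℝ, E) α.1)
  have h6 : (fun q : Q ↦ g • q) ∘ (extChartAt 𝓘(ℝ, E) α.1).symm =ᶠ[𝓝 x₀]
      (extChartAt 𝓘(ℝ, E) α.1).symm ∘ (fun x : E ↦ actionInChart G 𝓘(ℝ, E) α.1 (a, x)) := by
    have hc : ContinuousAt (fun x : E ↦ g • (extChartAt 𝓘(ℝ, E) α.1).symm x) x₀ :=
      (contMDiff_smul_right F (E := E) g).continuous.continuousAt.comp (continuousAt_extChartAt_symm α.1)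
    have hm : (extChartAt 𝓘(ℝ, E) α.1).source ∈ 𝓝 (g • (extChartAt 𝓘(ℝ, E) α.1).symm x₀) := by
      rw [hx₀, extChartAt_to_inv]
      exact (isOpen_extChartAt_source α.1).mem_nhds hsrc
    filter_upwards [hc.preimage_mem_nhds hm] with x hx
    exact ((extChartAt 𝓘(ℝ, E) α.1).left_inv hx).symm
  have h7 := hasMFDerivAt_unique (h3.congr_of_eventuallyEq h6) h5
  rw [hx₀, extChartAt_to_inv, ← hx₀, ← hxe] at h7
  have h8 : (chartSymmDeriv 𝓘(ℝ, E) α.1 (extChartAt 𝓘(ℝ, E) α.1 (g • α.1))).comp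
      ((fderiv ℝ (actionInChart G 𝓘(ℝ, E) α.1) (a, x₀)).comp (ContinuousLinearMap.inr ℝ F E)) =
      smulDeriv E g α.1 := h7
  have h9 := smulDeriv_mul F (E := E) g⁻¹ g α.1
  rw [inv_mul_cancel, smulDeriv_one] at h9
  rw [liftInChart, ← hg, cotangent_extChartAt_apply' ha, covector_cotangentLift]
  change ((((covector α).comp (smulDeriv E g⁻¹ (g • α.1))).comp
    (chartSymmDeriv 𝓘(ℝ, E) α.1 (extChartAt 𝓘(ℝ, E) α.1 (g • α.1)))).comp _) = _
  rw [ContinuousLinearMap.comp_assoc, h8, ContinuousLinearMap.comp_assoc, ← h9,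
    ContinuousLinearMap.comp_id]

theorem liftGenerator_fst (α : CotangentBundle E Q) (ξ : F) : (liftGenerator F G α ξ).1 =
    generatorInChart G 𝓘(ℝ, E) α.1 (extChartAt 𝓘(ℝ, E) α.1 α.1) ξ := by
  have h1 := (hasFDerivAt_fst (𝕜 := ℝ)).comp _ (hasFDerivAt_liftInChart (F := F) (G := G) α)
  have h2 := (hasFDerivAt_actionInChart_left (F := F) (G := G) 𝓘(ℝ, E) α.1
    (mem_extChartAt_target α.1)).congr_of_eventuallyEq (liftInChart_fst α)
  exact DFunLike.congr_fun (h1.unique h2) ξ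

/-- The derivative of `liftInChart_snd` at `1` expresses the fibre component by the mixed second
derivative of the action, group variable outermost; symmetry of second derivatives turns this into
the derivative of the generator along `v`. -/
theorem liftGenerator_snd (α : CotangentBundle E Q) (ξ : F) (v : E) :
    (liftGenerator F G α ξ).2 v =
      -covector α (fderiv ℝ (generatorInChart G 𝓘(ℝ, E) α.1) (extChartAt 𝓘(ℝ, E) α.1 α.1) v ξ) := by
  set a₀ := extChartAt 𝓘(ℝ, F) (1 : G) 1 with ha₀
  set x₀ := extChartAt 𝓘(ℝ, E) α.1 α.1 with hx₀
  set f := actionInChart G 𝓘(ℝ, E) α.1 (F := F) with hf_def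
  have hf : ContDiffAt ℝ ∞ f (a₀, x₀) :=
    contDiffAt_actionInChart (F := F) (G := G) 𝓘(ℝ, E) α.1 (mem_extChartAt_target α.1)
  have hsymm : IsSymmSndFDerivAt ℝ f (a₀, x₀) := hf.isSymmSndFDerivAt
    (by rw [minSmoothness_of_isRCLikeNormedField]; exact ENat.LEInfty.out)
  have hf' : HasFDerivAt (fderiv ℝ f) (fderiv ℝ (fderiv ℝ f) (a₀, x₀)) (a₀, x₀) :=
    ((hf.fderiv_right (m := ∞) (by simp)).differentiableAt (by simp)).hasFDerivAt
  have h1 : HasFDerivAt (generatorInChart G 𝓘(ℝ, E) α.1 : E → F →L[ℝ] E) _ x₀ :=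
    (HasFDerivAt.comp (g := fderiv ℝ f) (f := fun x : E ↦ (a₀, x)) x₀ hf'
      ((hasFDerivAt_const a₀ x₀).prodMk (hasFDerivAt_id (𝕜 := ℝ) x₀))).clm_comp
      (hasFDerivAt_const (ContinuousLinearMap.inl ℝ F E) x₀)
  have h1' : fderiv ℝ (generatorInChart G 𝓘(ℝ, E) α.1) x₀ v ξ =
      fderiv ℝ (fderiv ℝ f) (a₀, x₀) (0, v) (ξ, 0) := by
    rw [h1.fderiv]
    simp
  have h2 := (((hasFDerivAt_snd (𝕜 := ℝ)).comp _
    (hasFDerivAt_liftInChart (F := F) (G := G) α)).clm_comp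
    ((HasFDerivAt.comp (g := fderiv ℝ f) (f := fun a : F ↦ (a, x₀)) a₀ hf'
      ((hasFDerivAt_id (𝕜 := ℝ) a₀).prodMk (hasFDerivAt_const x₀ a₀))).clm_comp
      (hasFDerivAt_const (ContinuousLinearMap.inr ℝ F E) a₀)))
  have h3 := h2.unique ((hasFDerivAt_const (covector α) a₀).congr_of_eventuallyEq
    (liftInChart_snd (F := F) (G := G) α))
  have h4 := DFunLike.congr_fun (DFunLike.congr_fun h3 ξ) v
  have h5 : (liftInChart G α a₀).2 = covector α := by
    rw [liftInChart, ha₀, extChartAt_to_inv, cotangentLift_one, extChartAt_self_eq]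
  have h6 : fderiv ℝ f (a₀, x₀) (0, v) = v := by
    have h7 := HasFDerivAt.comp (g := f) (f := fun x : E ↦ (a₀, x)) x₀
      (hf.differentiableAt (by simp)).hasFDerivAt
      ((hasFDerivAt_const a₀ x₀).prodMk (hasFDerivAt_id (𝕜 := ℝ) x₀))
    have h8 : f ∘ (fun x : E ↦ (a₀, x)) =ᶠ[𝓝 x₀] id := by
      filter_upwards [extChartAt_target_mem_nhds (I := 𝓘(ℝ, E)) α.1] with x hx
      exact actionInChart_one (F := F) (G := G) 𝓘(ℝ, E) α.1 hx
    exact DFunLike.congr_fun (h7.unique ((hasFDerivAt_id x₀).congr_of_eventuallyEq h8)) v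
  rw [h1', hsymm]
  simp at h4
  rw [h5, h6] at h4
  exact eq_neg_of_add_eq_zero_right h4

/-- The left side is `ω_Q(ξ_{T*Q}, Y)` in coordinates: lifted generators are the Hamiltonian vector
fields of the components of `J`. -/
theorem momentumDeriv_eq (α : CotangentBundle E Q) (ξ : F) (Y : E × (E →L[ℝ] ℝ)) :
    Y.2 (liftGenerator F G α ξ).1 - (liftGenerator F G α ξ).2 Y.1 = momentumDeriv F G α Y ξ := by
  rw [momentumDeriv_apply, liftGenerator_fst, liftGenerator_snd, extChartAt_self_eq, sub_neg_eq_add]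

/-- Vertical directions suffice, since `J` is linear on each fibre, where it is precomposition with
the injective generator. -/
theorem surjective_momentumDeriv [FiniteDimensional ℝ E] {α : CotangentBundle E Q}
    (hinj : Function.Injective (modelGenerator F G 𝓘(ℝ, E) α.1)) :
    Function.Surjective (momentumDeriv F G α) := by
  obtain ⟨B, hB⟩ := exists_continuousLinearMap_leftInverse _ hinj
  intro ν
  refine ⟨(0, ν.comp B), ?_⟩
  ext ξ
  rw [momentumDeriv_apply, extChartAt_self_eq, map_zero, _root_.zero_apply, map_zero, add_zero,
    ← modelGenerator_eq]
  exact congrArg ν (DFunLike.congr_fun hB ξ)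

theorem injective_liftGenerator [CompleteSpace F] {α : CotangentBundle E Q}
    (hfree : ∀ g : G, g • α.1 = α.1 → g = 1) : Function.Injective (liftGenerator F G α) := by
  let _ := cotangentMulAction F G E Q
  have := contMDiffSMul_cotangentMulAction (F := F) (G := G) (E := E) (Q := Q)
  exact injective_modelGenerator (F := F) (G := G) (cotangentModel E) (m := α)
    fun g hg ↦ hfree g (congrArg (fun β : CotangentBundle E Q ↦ β.1) hg)

end LiftedGenerator
section OrbitCurves

variable {F : Type*} [NormedAddCommGroup F] [NormedSpace ℝ F]
  {G : Type*} [TopologicalSpace G] [ChartedSpace F G] [Group G] [LieGroup 𝓘(ℝ, F) ∞ G]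
  {V : Type*} [NormedAddCommGroup V] [NormedSpace ℝ V] {H : Type*} [TopologicalSpace H]
  (I : ModelWithCorners ℝ V H) [I.Boundaryless]
  {M : Type*} [TopologicalSpace M] [ChartedSpace H M] [IsManifold I ∞ M]
  [MulAction G M] [ContMDiffSMul 𝓘(ℝ, F) I ∞ G M]

/-! ### Curves in orbits -/

/-- Write `h • m = (h * g⁻¹) • (g • m)` and differentiate at `h = g`. -/
theorem mfderiv_smul_mem_range (g : G) (m : M) (X : F) :
    (mfderiv 𝓘(ℝ, F) I (fun h : G ↦ h • m) g : F →L[ℝ] V) X ∈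
      range (modelGenerator F G I (g • m)) := by
  have h1 : MDifferentiableAt 𝓘(ℝ, F) 𝓘(ℝ, F) (fun h : G ↦ h * g⁻¹) g :=
    (contMDiff_mul_right (I := 𝓘(ℝ, F)) (n := ∞)).mdifferentiableAt (by simp)
  have h2 : MDifferentiableAt 𝓘(ℝ, F) I (fun h : G ↦ h • g • m) (g * g⁻¹) :=
    (contMDiff_smul_left I _).mdifferentiableAt (by simp)
  have h3 := h2.hasMFDerivAt.comp g h1.hasMFDerivAt
  have h4 : (fun h : G ↦ h • g • m) ∘ (fun h : G ↦ h * g⁻¹) = fun h : G ↦ h • m := by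
    ext h
    simp [mul_smul]
  rw [h4, mul_inv_cancel] at h3
  rw [h3.mfderiv]
  exact ⟨_, rfl⟩

/-- The curve joining `m` to `g • m` by a segment in the chart of `G` at `1`, where `v` is the
direction of that segment. -/
def orbitCurve (v : F) (m : M) (t : ℝ) : M :=
  (extChartAt 𝓘(ℝ, F) (1 : G)).symm (extChartAt 𝓘(ℝ, F) (1 : G) 1 + t • v) • m

theorem contMDiffOn_orbitCurve (v : F) (m : M) :
    ContMDiffOn 𝓘(ℝ, ℝ) I ∞ (orbitCurve (G := G) v m)
      {t | extChartAt 𝓘(ℝ, F) (1 : G) 1 + t • v ∈ (extChartAt 𝓘(ℝ, F) (1 : G)).target} := by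
  have h1 : ContMDiff 𝓘(ℝ, ℝ) 𝓘(ℝ, F) ∞
      (fun t : ℝ ↦ extChartAt 𝓘(ℝ, F) (1 : G) 1 + t • v) :=
    (contDiff_const.add (contDiff_id.smul contDiff_const)).contMDiff
  exact (contMDiff_smul_left I m).comp_contMDiffOn
    ((contMDiffOn_extChartAt_symm (1 : G)).comp h1.contMDiffOn fun t ht ↦ ht)

theorem isOpen_orbitCurve_domain (v : F) :
    IsOpen {t : ℝ | extChartAt 𝓘(ℝ, F) (1 : G) 1 + t • v ∈
      (extChartAt 𝓘(ℝ, F) (1 : G)).target} :=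
  (isOpen_extChartAt_target (1 : G)).preimage (by fun_prop)

theorem orbitCurve_zero (v : F) (m : M) : orbitCurve (G := G) v m 0 = m := by
  rw [orbitCurve, zero_smul, add_zero, extChartAt_to_inv, one_smul]

theorem mfderiv_orbitCurve_zero (v : F) (m : M) :
    (mfderiv 𝓘(ℝ, ℝ) I (orbitCurve (G := G) v m) 0 (1 : ℝ) : V) = modelGenerator F G I m v := by
  set a₀ := extChartAt 𝓘(ℝ, F) (1 : G) 1 with ha₀
  have h1 : HasFDerivAt (fun t : ℝ ↦ a₀ + t • v) ((ContinuousLinearMap.id ℝ ℝ).smulRight v) 0 :=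
    ((hasFDerivAt_id (𝕜 := ℝ) (0 : ℝ)).smul_const v).const_add a₀
  have h2 : HasMFDerivAt 𝓘(ℝ, F) 𝓘(ℝ, F) (extChartAt 𝓘(ℝ, F) (1 : G)).symm (a₀ + (0 : ℝ) • v)
      (ContinuousLinearMap.id ℝ F) := by
    rw [zero_smul, add_zero]
    exact hasMFDerivAt_extChartAt_symm_self 𝓘(ℝ, F) (1 : G)
  have h3 : MDifferentiableAt 𝓘(ℝ, F) I (fun h : G ↦ h • m)
      ((extChartAt 𝓘(ℝ, F) (1 : G)).symm (a₀ + (0 : ℝ) • v)) :=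
    (contMDiff_smul_left I _).mdifferentiableAt (by simp)
  have h4 := h3.hasMFDerivAt.comp (0 : ℝ) (h2.comp (0 : ℝ) h1.hasMFDerivAt)
  have h5 : (extChartAt 𝓘(ℝ, F) (1 : G)).symm (a₀ + (0 : ℝ) • v) = 1 := by
    rw [zero_smul, add_zero, ha₀, extChartAt_to_inv]
  rw [h5] at h4
  have h6 : mfderiv 𝓘(ℝ, ℝ) I (orbitCurve (G := G) v m) 0 = _ := h4.mfderiv
  rw [h6]
  change modelGenerator F G I m ((1 : ℝ) • v) = _
  rw [one_smul]

theorem mfderiv_orbitCurve_mem_range (v : F) (m : M) {t : ℝ}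
    (ht : extChartAt 𝓘(ℝ, F) (1 : G) 1 + t • v ∈ (extChartAt 𝓘(ℝ, F) (1 : G)).target) :
    (mfderiv 𝓘(ℝ, ℝ) I (orbitCurve (G := G) v m) t (1 : ℝ) : V) ∈
      range (modelGenerator F G I (orbitCurve (G := G) v m t)) := by
  have h1 : MDifferentiableAt 𝓘(ℝ, ℝ) 𝓘(ℝ, F)
      (fun t : ℝ ↦ extChartAt 𝓘(ℝ, F) (1 : G) 1 + t • v) t :=
    DifferentiableAt.mdifferentiableAt (by fun_prop)
  have h2 : MDifferentiableAt 𝓘(ℝ, F) 𝓘(ℝ, F) (extChartAt 𝓘(ℝ, F) (1 : G)).symm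
      (extChartAt 𝓘(ℝ, F) (1 : G) 1 + t • v) :=
    ((contMDiffOn_extChartAt_symm (n := 1) (1 : G)).contMDiffAt
      ((isOpen_extChartAt_target (1 : G)).mem_nhds ht)).mdifferentiableAt one_ne_zero
  have h3 : MDifferentiableAt 𝓘(ℝ, F) I (fun h : G ↦ h • m)
      ((extChartAt 𝓘(ℝ, F) (1 : G)).symm (extChartAt 𝓘(ℝ, F) (1 : G) 1 + t • v)) :=
    (contMDiff_smul_left I _).mdifferentiableAt (by simp)
  have h4 : mfderiv 𝓘(ℝ, ℝ) I (orbitCurve (G := G) v m) t = _ :=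
    (h3.hasMFDerivAt.comp t (h2.hasMFDerivAt.comp t h1.hasMFDerivAt)).mfderiv
  rw [h4]
  exact mfderiv_smul_mem_range I _ m _

variable (F G) in
/-- Near `1`, group elements are reached by curves that stay in the chart. -/
theorem eventually_exists_orbitCurve_eq :
    ∀ᶠ g in 𝓝 (1 : G), ∃ v : F,
      (∀ t ∈ Icc (0 : ℝ) 1,
        extChartAt 𝓘(ℝ, F) (1 : G) 1 + t • v ∈ (extChartAt 𝓘(ℝ, F) (1 : G)).target) ∧
      (extChartAt 𝓘(ℝ, F) (1 : G)).symm (extChartAt 𝓘(ℝ, F) (1 : G) 1 + (1 : ℝ) • v) = g := by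
  obtain ⟨r, hr, hball⟩ := Metric.mem_nhds_iff.1 (extChartAt_target_mem_nhds (I := 𝓘(ℝ, F)) (1 : G))
  filter_upwards [extChartAt_source_mem_nhds (I := 𝓘(ℝ, F)) (1 : G),
    (continuousAt_extChartAt (I := 𝓘(ℝ, F)) (1 : G)).preimage_mem_nhds (Metric.ball_mem_nhds _ hr)]
    with g hg hgr
  refine ⟨extChartAt 𝓘(ℝ, F) (1 : G) g - extChartAt 𝓘(ℝ, F) (1 : G) 1, fun t ht ↦ hball ?_, ?_⟩
  · exact (convex_ball _ r).add_smul_sub_mem (Metric.mem_ball_self hr) hgr ht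
  · rw [one_smul, add_sub_cancel]
    exact (extChartAt 𝓘(ℝ, F) (1 : G)).left_inv hg

variable (G) in
-- The orbit enters as a bare subset, so a curve in it yields elements `g t` chosen pointwise, with
-- no regularity. The hypothesis `hlim`, supplied by properness, gives `g t → 1`, and that is all
-- the local invariant requires.
theorem tangentSpaceOf_orbit [FiniteDimensional ℝ V] {m : M}
    (hinj : Function.Injective (modelGenerator F G I m))
    (hlim : ∀ g : ℝ → G, Filter.Tendsto (fun t ↦ g t • m) (𝓝 0) (𝓝 m) →
      Filter.Tendsto g (𝓝 0) (𝓝 1)) :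
    tangentSpaceOf I (range fun g : G ↦ g • m) m = range (modelGenerator F G I m) := by
  ext X
  constructor
  · intro hX
    obtain ⟨γ, ε, hε, hγ, hγC, h0, hX'⟩ := exists_of_mem_tangentSpaceOf (V := V) hX
    have hn : Ioo (-ε) ε ∈ 𝓝 (0 : ℝ) := Ioo_mem_nhds (by simpa) hε
    have h1 : ∀ t, ∃ g : G, t ∈ Ioo (-ε) ε → γ t = g • m := by
      intro t
      by_cases ht : t ∈ Ioo (-ε) ε
      · obtain ⟨g, hg⟩ := hγC t ht
        exact ⟨g, fun _ ↦ hg.symm⟩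
      · exact ⟨1, fun h ↦ absurd h ht⟩
    choose g hg using h1
    have hd := (hγ.contMDiffAt hn).mdifferentiableAt (by simp)
    have hgm : ∀ᶠ t in 𝓝 (0 : ℝ), γ t = g t • m := Filter.mem_of_superset hn hg
    have h2 := mfderiv_mem_range_modelGenerator I m hinj h0 hd (g := g)
      (hlim g (Filter.Tendsto.congr' hgm (by simpa [ContinuousAt, h0] using hd.continuousAt))) hgm
    obtain ⟨ξ, hξ⟩ := h2
    exact ⟨ξ, hξ.trans hX'⟩
  · rintro ⟨ξ, rfl⟩
    have h0 : (0 : ℝ) ∈ {t : ℝ | extChartAt 𝓘(ℝ, F) (1 : G) 1 + t • ξ ∈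
        (extChartAt 𝓘(ℝ, F) (1 : G)).target} := by simp
    obtain ⟨ε, hε, hball⟩ := Metric.isOpen_iff.1 (isOpen_orbitCurve_domain (G := G) ξ) 0 h0
    rw [Real.ball_eq_Ioo, zero_sub, zero_add] at hball
    exact mem_tangentSpaceOf (V := V) hε ((contMDiffOn_orbitCurve I ξ m).mono hball)
      (fun t _ ↦ ⟨_, rfl⟩) (orbitCurve_zero ξ m) (mfderiv_orbitCurve_zero I ξ m)

end OrbitCurves
section Reduction

variable {F : Type*} [NormedAddCommGroup F] [NormedSpace ℝ F] [FiniteDimensional ℝ F]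
  {G : Type*} [TopologicalSpace G] [ChartedSpace F G] [Group G] [LieGroup 𝓘(ℝ, F) ∞ G]
  {E : Type*} [NormedAddCommGroup E] [NormedSpace ℝ E] [FiniteDimensional ℝ E]
  {Q : Type*} [TopologicalSpace Q] [ChartedSpace E Q] [IsManifold 𝓘(ℝ, E) ∞ Q]
  [MulAction G Q] [ContMDiffSMul 𝓘(ℝ, F) 𝓘(ℝ, E) ∞ G Q]

/-! ### The level sets of the momentum map -/

theorem isEmbeddedSubmanifold_momentumLevel (hfree : ∀ (g : G) (q : Q), g • q = q → g = 1)
    (μ : GroupLieAlgebra 𝓘(ℝ, F) G →L[ℝ] ℝ) :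
    IsEmbeddedSubmanifold (cotangentModel E) (momentumLevel E Q μ) :=
  isEmbeddedSubmanifold_levelSet (cotangentModel E) (contMDiff_modelMomentumMap F G)
    (μ : F →L[ℝ] ℝ) fun α _ ↦ surjective_momentumDeriv
      (injective_modelGenerator 𝓘(ℝ, E) fun g ↦ hfree g α.1)

theorem mem_tangentSpaceOf_momentumLevel (hfree : ∀ (g : G) (q : Q), g • q = q → g = 1)
    {μ : GroupLieAlgebra 𝓘(ℝ, F) G →L[ℝ] ℝ} {α : CotangentBundle E Q}
    (hα : α ∈ momentumLevel E Q μ) (X : E × (E →L[ℝ] ℝ)) :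
    (X : TangentSpace (cotangentModel E) α) ∈
      tangentSpaceOf (cotangentModel E) (momentumLevel E Q μ) α ↔ momentumDeriv F G α X = 0 := by
  have hJ : momentumLevel E Q μ = {β | modelMomentumMap F G β = modelMomentumMap F G α} := by
    cases hα
    rfl
  rw [hJ]
  exact ⟨mfderiv_eq_zero_of_mem_tangentSpaceOf (cotangentModel E)
      (contMDiff_modelMomentumMap F G) α,
    mem_tangentSpaceOf_levelSet (cotangentModel E) (contMDiff_modelMomentumMap F G) α
      (surjective_momentumDeriv (injective_modelGenerator 𝓘(ℝ, E) fun g ↦ hfree g α.1))⟩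

theorem canonicalForm_liftGenerator (α : CotangentBundle E Q) (ξ : F) (Y : E × (E →L[ℝ] ℝ)) :
    canonicalForm α (liftGenerator F G α ξ) Y = momentumDeriv F G α Y ξ := by
  rw [← momentumDeriv_eq]
  exact canonicalForm_apply α _ Y

/-- The symplectic core: the momentum map identity and linear algebra at a regular point, valid on
every level set. -/
theorem orthogonalOf_tangentSpaceOf_momentumLevel
    (hfree : ∀ (g : G) (q : Q), g • q = q → g = 1)
    {μ : GroupLieAlgebra 𝓘(ℝ, F) G →L[ℝ] ℝ} {α : CotangentBundle E Q}
    (hα : α ∈ momentumLevel E Q μ) :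
    orthogonalOf (cotangentModel E) canonicalForm α
      (tangentSpaceOf (cotangentModel E) (momentumLevel E Q μ) α) =
      range (liftGenerator F G α) := by
  ext X
  constructor
  · intro hX
    refine mem_range_of_forall_mem_ker (momentumDeriv F G α) (liftGenerator F G α)
      (surjective_momentumDeriv (injective_modelGenerator 𝓘(ℝ, E) fun g ↦ hfree g α.1))
      (momentumDeriv_eq α) fun Y hY ↦ ?_
    rw [← canonicalForm_apply α X Y]
    exact hX Y ((mem_tangentSpaceOf_momentumLevel hfree hα Y).2 hY)
  · rintro ⟨ξ, rfl⟩ Y hY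
    exact (canonicalForm_liftGenerator α ξ Y).trans
      (DFunLike.congr_fun ((mem_tangentSpaceOf_momentumLevel hfree hα Y).1 hY) ξ)

theorem cotangentLift_mem_momentumLevel {μ : GroupLieAlgebra 𝓘(ℝ, F) G →L[ℝ] ℝ}
    (hμ : coadjointIsotropy μ = univ) (g : G) {α : CotangentBundle E Q}
    (hα : α ∈ momentumLevel E Q μ) : cotangentLift g α ∈ momentumLevel E Q μ := by
  have h1 : g ∈ coadjointIsotropy μ := hμ ▸ mem_univ g
  have h2 : momentumMap α = μ := hα
  change momentumMap (cotangentLift g α) = μ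
  rw [momentumMap_cotangentLift, h2]
  exact h1

theorem momentumDeriv_liftGenerator {μ : GroupLieAlgebra 𝓘(ℝ, F) G →L[ℝ] ℝ}
    (hμ : coadjointIsotropy μ = univ) {α : CotangentBundle E Q}
    (hα : α ∈ momentumLevel E Q μ) (ξ : F) :
    momentumDeriv F G α (liftGenerator F G α ξ) = 0 := by
  have h1 : MDifferentiableAt 𝓘(ℝ, F) (cotangentModel E) (fun g : G ↦ cotangentLift g α) 1 :=
    ((contMDiff_cotangentLift (F := F)).comp
      (contMDiff_id.prodMk contMDiff_const)).mdifferentiableAt (by simp)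
  have h2 : MDifferentiableAt (cotangentModel E) 𝓘(ℝ, F →L[ℝ] ℝ)
      (modelMomentumMap F G : CotangentBundle E Q → F →L[ℝ] ℝ) (cotangentLift (1 : G) α) :=
    (contMDiff_modelMomentumMap F G).mdifferentiableAt (by simp)
  have h3 := h2.hasMFDerivAt.comp (1 : G) h1.hasMFDerivAt
  have h4 : (modelMomentumMap F G : CotangentBundle E Q → F →L[ℝ] ℝ) ∘
      (fun g : G ↦ cotangentLift g α) = fun _ ↦ modelMomentumMap F G α :=
    funext fun g ↦ (cotangentLift_mem_momentumLevel hμ g hα).trans (Eq.symm hα)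
  rw [h4] at h3
  have h5 := hasMFDerivAt_unique h3 (hasMFDerivAt_const (modelMomentumMap F G α) (1 : G))
  rw [cotangentLift_one] at h5
  exact DFunLike.congr_fun h5 ξ

theorem range_liftGenerator_subset (hfree : ∀ (g : G) (q : Q), g • q = q → g = 1)
    {μ : GroupLieAlgebra 𝓘(ℝ, F) G →L[ℝ] ℝ} (hμ : coadjointIsotropy μ = univ)
    {α : CotangentBundle E Q} (hα : α ∈ momentumLevel E Q μ) :
    range (liftGenerator F G α) ⊆
      tangentSpaceOf (cotangentModel E) (momentumLevel E Q μ) α := by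
  rintro _ ⟨ξ, rfl⟩
  exact (mem_tangentSpaceOf_momentumLevel hfree hα _).2 (momentumDeriv_liftGenerator hμ hα ξ)

/-- For a coisotropic submanifold, intersecting the orthogonal with the tangent space changes
nothing. -/
theorem characteristicDistribution_momentumLevel
    (hfree : ∀ (g : G) (q : Q), g • q = q → g = 1)
    {μ : GroupLieAlgebra 𝓘(ℝ, F) G →L[ℝ] ℝ} (hμ : coadjointIsotropy μ = univ)
    {α : CotangentBundle E Q} (hα : α ∈ momentumLevel E Q μ) :
    characteristicDistribution (cotangentModel E) canonicalForm (momentumLevel E Q μ) α =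
      range (liftGenerator F G α) := by
  rw [← orthogonalOf_tangentSpaceOf_momentumLevel hfree hα]
  refine Subset.antisymm (fun X hX ↦ hX.2) fun X hX ↦ ⟨?_, hX⟩
  rw [orthogonalOf_tangentSpaceOf_momentumLevel hfree hα] at hX
  exact range_liftGenerator_subset hfree hμ hα hX

/-- Properness on `Q` is enough: the projection is equivariant and continuous, so `g t α → α`
implies `g t • q → q` for the base point `q`. -/
theorem tangentSpaceOf_cotangentOrbit [ProperSMul G Q]
    (hfree : ∀ (g : G) (q : Q), g • q = q → g = 1) (α : CotangentBundle E Q) :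
    tangentSpaceOf (cotangentModel E) (cotangentOrbit G α) α = range (liftGenerator F G α) := by
  let _ := cotangentMulAction F G E Q
  have := contMDiffSMul_cotangentMulAction (F := F) (G := G) (E := E) (Q := Q)
  refine tangentSpaceOf_orbit G (cotangentModel E) (F := F) (m := α)
    (injective_liftGenerator fun g ↦ hfree g α.1) fun g hg ↦ ?_
  exact tendsto_one_of_tendsto_smul (fun g ↦ hfree g α.1)
    ((contMDiff_cotangentProj.continuous.tendsto α).comp hg)

/-! ### The characteristic leaves -/

theorem mem_cotangentOrbit_of_characteristicSetoid
    (hfree : ∀ (g : G) (q : Q), g • q = q → g = 1)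
    {μ : GroupLieAlgebra 𝓘(ℝ, F) G →L[ℝ] ℝ} (hμ : coadjointIsotropy μ = univ)
    {α β : momentumLevel E Q μ}
    (h : characteristicSetoid (cotangentModel E) canonicalForm (momentumLevel E Q μ) α β) :
    (β : CotangentBundle E Q) ∈ cotangentOrbit G (α : CotangentBundle E Q) := by
  let _ := cotangentMulAction F G E Q
  have := contMDiffSMul_cotangentMulAction (F := F) (G := G) (E := E) (Q := Q)
  induction h with
  | rel x y h =>
    obtain ⟨γ, h0, h1, hγ, hv⟩ := h
    obtain ⟨g, hg⟩ := exists_smul_eq_of_velocity_mem_range (F := F) (G := G) (cotangentModel E)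
      (fun α ↦ show Function.Injective (liftGenerator F G α) from
        injective_liftGenerator fun g ↦ hfree g α.1)
      (hγ.mdifferentiableOn (by simp)) fun t ht ↦ by
        have h2 := (hv t ht).2
        rw [characteristicDistribution_momentumLevel hfree hμ (hv t ht).1] at h2
        exact h2
    rw [h0, h1] at hg
    exact ⟨g, hg⟩
  | refl x => exact ⟨1, cotangentLift_one _⟩
  | symm x y _ ih =>
    obtain ⟨g, hg⟩ := ih
    refine ⟨g⁻¹, ?_⟩
    change g⁻¹ • (y : CotangentBundle E Q) = x
    exact inv_smul_eq_iff.2 (Eq.symm hg)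
  | trans x y z _ _ ih₁ ih₂ =>
    obtain ⟨g, hg⟩ := ih₁
    obtain ⟨h, hh⟩ := ih₂
    refine ⟨h * g, ?_⟩
    change (h * g) • (x : CotangentBundle E Q) = z
    rw [mul_smul]
    exact (congrArg (h • ·) hg).trans hh

/-- The path from `1` to `g` is chosen in `G` alone, so one neighbourhood of `1` serves all `α` at
once; this uniformity is what shows the subgroup in `characteristicSetoid_cotangentLift` to be open.
-/
theorem eventually_joinedByCharacteristicCurve
    (hfree : ∀ (g : G) (q : Q), g • q = q → g = 1)
    {μ : GroupLieAlgebra 𝓘(ℝ, F) G →L[ℝ] ℝ} (hμ : coadjointIsotropy μ = univ) :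
    ∀ᶠ g in 𝓝 (1 : G), ∀ α : momentumLevel E Q μ,
      JoinedByCharacteristicCurve (cotangentModel E) canonicalForm (momentumLevel E Q μ) α
        ⟨cotangentLift g (α : CotangentBundle E Q),
          cotangentLift_mem_momentumLevel hμ g α.2⟩ := by
  let _ := cotangentMulAction F G E Q
  have := contMDiffSMul_cotangentMulAction (F := F) (G := G) (E := E) (Q := Q)
  filter_upwards [eventually_exists_orbitCurve_eq F G] with g ⟨v, hv, hv1⟩ α
  have hsm := contMDiffOn_orbitCurve (F := F) (G := G) (cotangentModel E) v
    (α : CotangentBundle E Q)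
  refine ⟨orbitCurve (G := G) v (α : CotangentBundle E Q), orbitCurve_zero v _, ?_,
    hsm.mono hv, fun t ht ↦ ?_⟩
  · rw [orbitCurve, hv1]
    rfl
  · have hmem : orbitCurve (G := G) v (α : CotangentBundle E Q) t ∈ momentumLevel E Q μ :=
      cotangentLift_mem_momentumLevel hμ _ α.2
    refine ⟨hmem, ?_⟩
    have hd := (hsm.contMDiffAt
      ((isOpen_orbitCurve_domain (G := G) v).mem_nhds (hv t ht))).mdifferentiableAt (by simp)
    rw [characteristicDistribution_momentumLevel hfree hμ hmem, mfderivWithin_eq_mfderiv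
      ((uniqueDiffOn_Icc zero_lt_one t ht).uniqueMDiffWithinAt) hd]
    exact mfderiv_orbitCurve_mem_range (F := F) (G := G) (cotangentModel E) v
      (α : CotangentBundle E Q) (hv t ht)

theorem characteristicSetoid_cotangentLift [ConnectedSpace G]
    (hfree : ∀ (g : G) (q : Q), g • q = q → g = 1)
    {μ : GroupLieAlgebra 𝓘(ℝ, F) G →L[ℝ] ℝ} (hμ : coadjointIsotropy μ = univ)
    (g : G) (α : momentumLevel E Q μ) :
    characteristicSetoid (cotangentModel E) canonicalForm (momentumLevel E Q μ) α
      ⟨cotangentLift g (α : CotangentBundle E Q),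
        cotangentLift_mem_momentumLevel hμ g α.2⟩ := by
  let s := characteristicSetoid (cotangentModel E) canonicalForm (momentumLevel E Q μ)
  -- The elements moving every point within its leaf. This subgroup contains a neighbourhood of `1`,
  -- so it is open, hence closed, hence all of the connected group `G`.
  let S : Subgroup G :=
    { carrier := {g | ∀ α : momentumLevel E Q μ, s α
        ⟨cotangentLift g (α : CotangentBundle E Q),
          cotangentLift_mem_momentumLevel hμ g α.2⟩}
      one_mem' := fun α ↦ by
        simp only [cotangentLift_one]
        exact s.refl' α
      mul_mem' := fun {g h} hg hh α ↦ by
        simp only [cotangentLift_mul F g h]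
        exact s.trans' (hh α) (hg _)
      inv_mem' := fun {g} hg α ↦ by
        have h1 := hg ⟨cotangentLift g⁻¹ (α : CotangentBundle E Q),
          cotangentLift_mem_momentumLevel hμ g⁻¹ α.2⟩
        simp only [← cotangentLift_mul F, mul_inv_cancel, cotangentLift_one] at h1
        exact s.symm' h1 }
  have : IsTopologicalGroup G := topologicalGroup_of_lieGroup 𝓘(ℝ, F) ∞
  have hopen : IsOpen (S : Set G) := S.isOpen_of_mem_nhds (g := 1) (by
    filter_upwards [eventually_joinedByCharacteristicCurve (E := E) (Q := Q) hfree hμ] with g hg α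
    exact Relation.EqvGen.rel _ _ (hg α))
  have huniv : (S : Set G) = univ :=
    IsClopen.eq_univ ⟨S.isClosed_of_isOpen hopen, hopen⟩ ⟨1, S.one_mem⟩
  have hgS : g ∈ (S : Set G) := huniv ▸ mem_univ g
  exact hgS α

end Reduction
end CotangentReduction

/-! ### Coisotropic reduction at a fully isotropic momentum value -/

theorem mainTheorem4
    {F : Type*} [NormedAddCommGroup F] [NormedSpace ℝ F] [FiniteDimensional ℝ F]
    {G : Type*} [TopologicalSpace G] [ChartedSpace F G] [Group G] [LieGroup 𝓘(ℝ, F) ∞ G]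
    [T2Space G] [SecondCountableTopology G] [ConnectedSpace G]
    {E : Type*} [NormedAddCommGroup E] [NormedSpace ℝ E] [FiniteDimensional ℝ E]
    {Q : Type*} [TopologicalSpace Q] [ChartedSpace E Q] [IsManifold 𝓘(ℝ, E) ∞ Q]
    [T2Space Q] [SecondCountableTopology Q]
    [MulAction G Q] [ContMDiffSMul 𝓘(ℝ, F) 𝓘(ℝ, E) ∞ G Q] [ProperSMul G Q]
    (hfree : ∀ (g : G) (q : Q), g • q = q → g = 1)
    (μ : GroupLieAlgebra 𝓘(ℝ, F) G →L[ℝ] ℝ)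
    (hμ : CotangentReduction.coadjointIsotropy μ = Set.univ) :
    -- `J⁻¹(μ)` is a coisotropic submanifold of `(T*Q, ω_Q)`
    CotangentReduction.IsCoisotropicSubmanifold (CotangentReduction.cotangentModel E)
      CotangentReduction.canonicalForm (CotangentReduction.momentumLevel E Q μ) ∧
    -- the symplectic orthogonal of its tangent space is the tangent space of the orbit
    (∀ α ∈ CotangentReduction.momentumLevel E Q μ,
      CotangentReduction.orthogonalOf (CotangentReduction.cotangentModel E)
        CotangentReduction.canonicalForm α
        (CotangentReduction.tangentSpaceOf (CotangentReduction.cotangentModel E)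
          (CotangentReduction.momentumLevel E Q μ) α) =
      CotangentReduction.tangentSpaceOf (CotangentReduction.cotangentModel E)
        (CotangentReduction.cotangentOrbit G α) α) ∧
    -- `J⁻¹(μ)` is `G`-invariant
    (∀ (g : G), ∀ α ∈ CotangentReduction.momentumLevel E Q μ,
      CotangentReduction.cotangentLift g α ∈ CotangentReduction.momentumLevel E Q μ) ∧
    -- the characteristic quotient of `J⁻¹(μ)` is `J⁻¹(μ)/G`
    (∀ α β : CotangentReduction.momentumLevel E Q μ,
      CotangentReduction.characteristicSetoid (CotangentReduction.cotangentModel E)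
        CotangentReduction.canonicalForm (CotangentReduction.momentumLevel E Q μ) α β ↔
      (β : CotangentReduction.CotangentBundle E Q) ∈
        CotangentReduction.cotangentOrbit G (α : CotangentReduction.CotangentBundle E Q)) := by
  refine ⟨⟨CotangentReduction.isEmbeddedSubmanifold_momentumLevel hfree μ, fun α hα ↦ ?_⟩,
    fun α hα ↦ ?_, fun g α hα ↦ CotangentReduction.cotangentLift_mem_momentumLevel hμ g hα,
    fun α β ↦
      ⟨CotangentReduction.mem_cotangentOrbit_of_characteristicSetoid hfree hμ, ?_⟩⟩
  · rw [CotangentReduction.orthogonalOf_tangentSpaceOf_momentumLevel hfree hα]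
    exact CotangentReduction.range_liftGenerator_subset hfree hμ hα
  · rw [CotangentReduction.orthogonalOf_tangentSpaceOf_momentumLevel hfree hα,
      CotangentReduction.tangentSpaceOf_cotangentOrbit (F := F) hfree]
  · rintro ⟨g, hg⟩
    have h := CotangentReduction.characteristicSetoid_cotangentLift hfree hμ g α
    have hβ : (⟨CotangentReduction.cotangentLift g
        (α : CotangentReduction.CotangentBundle E Q),
        CotangentReduction.cotangentLift_mem_momentumLevel hμ g α.2⟩ :
        CotangentReduction.momentumLevel E Q μ) = β := Subtype.ext hg
    rwa [hβ] at h
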